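/- Let $\mathcal{X}=\{0,1\}$ and let $x\mapsto \pi^{(x)}_{BW}$ be a classical-quantum channel with finite-dimensional outputs; write $\sigma_x=\mathrm{Tr}_W\,\pi^{(x)}_{BW}$ for Bob's and $\omega_x=\mathrm{Tr}_B\,\pi^{(x)}_{BW}$ for Willie's output state, the input $0$ being the innocent one. Assume $\mathrm{supp}(\sigma_1)\subseteq\mathrm{supp}(\sigma_0)$, $\mathrm{supp}(\omega_1)\subseteq\mathrm{supp}(\omega_0)$ and $\omega_1\neq\omega_0$. Logarithms are natural, $D(\rho\|\sigma)$ is the quantum relative entropy, and for $\sigma=\sum_i\lambda_i\Pi_i$ (spectral decomposition) $$\chi^2(\rho\|\sigma)=\sum_{i\neq j}\frac{\log\lambda_i-\log\lambda_j}{\lambda_i-\lambda_j}\mathrm{Tr}[(\rho-\sigma)\Pi_i(\rho-\sigma)\Pi_j]+\sum_i\frac1{\lambda_i}\mathrm{Tr}[(\rho-\sigma)\Pi_i(\rho-\sigma)\Pi_i]$$ is the quantum chi-square divergence (restricted to $\mathrm{supp}(\sigma)$). A secrecy code of length $n$ consists of finite non-empty sets $\mathcal{M}$ (secret messages), $\mathcal{L}$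 (public messages), $\mathcal{K}$ (keys), a deterministic encoder $f:\mathcal{M}\times\mathcal{L}\times\mathcal{K}\to\mathcal{X}^n$, and for each $k\in\mathcal{K}$ a measurement (POVM) $\{\Lambda^{(m,\ell|k)}\}_{(m,\ell)}$ on $B^n$. Messages and key are uniform and independent. Let $\overline{P}_e^{(n)}$ be the average probability of decoding error, $\rho^{(m)}_{W^n}$ Willie's state given $m$ (averaged over $\ell$ and $k$) and $\overline\rho_{W^n}$ its average over $m$. With respect to a covertness level $\delta^{\mathrm{cov}}$, the rates are $L_{\mathrm S}=\frac{\log|\mathcal M|}{\sqrt{n\delta^{\mathrm{cov}}}}$, $L_{\mathrm{public}}=\frac{\log|\mathcal L|}{\sqrt{n\delta^{\mathrm{cov}}}}$, $L_{\mathrm{key}}=\frac{\log|\mathcal K|}{\sqrt{n\delta^{\mathrm{cov}}}}$ (read as $0$ in the irrelevant case $n\delta^{\mathrm{cov}}\le 0$). Consider a sequence of such codes, one of each length $n$, and sequences $\varepsilon_n,\delta_n^{\mathrm{cov}},\delta_n^{\mathrm{sec}},\vartheta_n\to0$ such that, for all large $n$, with rates taken with respect to $\delta_n^{\mathrm{cov}}$,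 $$\overline P_e^{(n)}\le\varepsilon_n,\qquad D(\overline\rho_{W^n}\|\omega_0^{\otimes n})\le\delta_n^{\mathrm{cov}},\qquad \frac1{|\mathcal M_n|}\sum_{m}\big\|\rho^{(m)}_{W^n}-\breve\rho_{W^n}\big\|_1\le\delta_n^{\mathrm{sec}}$$ for some state $\breve\rho_{W^n}$ not depending on $m$, $L_{\mathrm{public}}=0$, $L_{\mathrm S}>0$, and $$L_{\mathrm S}\ge(1-\vartheta_n)\frac{D(\sigma_1\|\sigma_0)}{\sqrt{\frac12\chi^2(\omega_1\|\omega_0)}}.$$ Then there is a sequence $\lambda_n^{\mathrm{key}}\to0$ with $$L_{\mathrm{key}}\ge\frac{D(\omega_1\|\omega_0)}{\sqrt{\frac12\chi^2(\omega_1\|\omega_0)}}-\lambda_n^{\mathrm{key}}\qquad\text{for all } n.$$ -/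

import Mathlib

open Filter Topology
open scoped ComplexOrder

namespace CovertSecrecy

noncomputable section

/-! Operators on a finite-dimensional Hilbert space with orthonormal basis `d` are complex
matrices indexed by `d`; the space `H ^ ⊗ n` has the basis `Fin n → d`. All logarithms are
natural. -/

/-- Density operators: positive semidefinite with unit trace. -/
def IsDensity {d : Type*} [Fintype d] (ρ : Matrix d d ℂ) : Prop :=
  ρ.PosSemidef ∧ ρ.trace = 1

/-- The support of a Hermitian operator (the orthogonal complement of its kernel, i.e. its
range). -/
def supp {d : Type*} [Fintype d] [DecidableEq d] (A : Matrix d d ℂ) : Submodule ℂ (d → ℂ) :=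
  LinearMap.range (Matrix.toLin' A)

/-- The logarithm of a positive semidefinite operator (`log 0 = 0` on the kernel). -/
def logOp {d : Type*} [Fintype d] [DecidableEq d] (A : Matrix d d ℂ) : Matrix d d ℂ :=
  cfc Real.log A

open Classical in
/-- Umegaki relative entropy `D(ρ‖σ) = Tr[ρ (log ρ - log σ)]` if `supp ρ ⊆ supp σ`,
and `∞` otherwise. -/
def relEntropy {d : Type*} [Fintype d] [DecidableEq d] (ρ σ : Matrix d d ℂ) : EReal :=
  if supp ρ ≤ supp σ then (((ρ * (logOp ρ - logOp σ)).trace.re : ℝ) : EReal) else ⊤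

/-- The finite set of distinct eigenvalues of a Hermitian operator. -/
def eigs {d : Type*} [Fintype d] [DecidableEq d] (A : Matrix d d ℂ) : Finset ℝ :=
  (Matrix.finite_real_spectrum (A := A)).toFinset

/-- The spectral projection of a Hermitian operator onto the eigenspace of `a`. -/
def specProj {d : Type*} [Fintype d] [DecidableEq d] (A : Matrix d d ℂ) (a : ℝ) :
    Matrix d d ℂ :=
  cfc (fun t : ℝ => if t = a then (1 : ℝ) else 0) A

/-- The quantum chi-square divergence: with the spectral decomposition `σ = ∑ a, a • Π_a`,
the sum over pairs of distinct eigenvalues `a ≠ b` of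
`(log a - log b) / (a - b) * Tr[(ρ - σ) Π_a (ρ - σ) Π_b]`, plus the sum over the eigenvalues `a`
of `1 / a * Tr[(ρ - σ) Π_a (ρ - σ) Π_a]`. When `supp ρ ⊆ supp σ`, the traces
that involve the eigenvalue `0` vanish. -/
def chiSq {d : Type*} [Fintype d] [DecidableEq d] (ρ σ : Matrix d d ℂ) : ℝ :=
  (∑ a ∈ eigs σ, ∑ b ∈ (eigs σ).erase a,
      (Real.log a - Real.log b) / (a - b) *
        ((ρ - σ) * specProj σ a * (ρ - σ) * specProj σ b).trace.re) +
    ∑ a ∈ eigs σ, 1 / a * ((ρ - σ) * specProj σ a * (ρ - σ) * specProj σ a).trace.re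

/-- The trace norm `‖Q‖₁ = Tr √(Q† Q)`. -/
def traceNorm {d : Type*} [Fintype d] [DecidableEq d] (Q : Matrix d d ℂ) : ℝ :=
  (cfc Real.sqrt (Q.conjTranspose * Q)).trace.re

/-- Partial trace over the second tensor factor. -/
def trRight {b w : Type*} [Fintype w] (ρ : Matrix (b × w) (b × w) ℂ) : Matrix b b ℂ :=
  fun i j => ∑ k, ρ (i, k) (j, k)

/-- Partial trace over the first tensor factor. -/
def trLeft {b w : Type*} [Fintype b] (ρ : Matrix (b × w) (b × w) ℂ) : Matrix w w ℂ :=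
  fun i j => ∑ k, ρ (k, i) (k, j)

/-- The tensor product `A₁ ⊗ ⋯ ⊗ Aₙ`. -/
def tensor {d : Type*} {n : ℕ} (A : Fin n → Matrix d d ℂ) :
    Matrix (Fin n → d) (Fin n → d) ℂ :=
  fun u v => ∏ i, A i (u i) (v i)

/-- A classical-quantum channel with binary input alphabet `{0, 1}`, which maps the input `x` to a
joint state of Bob and the warden Willie. The input `0` is the innocent one. -/
structure CQChannel (b w : Type*) [Fintype b] [Fintype w] where
  /-- the joint output state -/
  out : Fin 2 → Matrix (b × w) (b × w) ℂ
  isDensity_out : ∀ x, IsDensity (out x)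

namespace CQChannel

variable {b w : Type*} [Fintype b] [Fintype w]

/-- Bob's output state `σ_x`. -/
def bob (P : CQChannel b w) (x : Fin 2) : Matrix b b ℂ := trRight (P.out x)

/-- Willie's output state `ω_x`. -/
def willie (P : CQChannel b w) (x : Fin 2) : Matrix w w ℂ := trLeft (P.out x)

/-- The joint state of `Bⁿ Wⁿ` for the input sequence `x`, the tensor product of the single-letter
outputs, with its basis sorted into the one of `Bⁿ` and the one of `Wⁿ`. -/
def outSeq (P : CQChannel b w) {n : ℕ} (x : Fin n → Fin 2) :
    Matrix ((Fin n → b) × (Fin n → w)) ((Fin n → b) × (Fin n → w)) ℂ :=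
  (tensor fun i => P.out (x i)).submatrix
    (Equiv.arrowProdEquivProdArrow (Fin n) (fun _ => b) (fun _ => w)).symm
    (Equiv.arrowProdEquivProdArrow (Fin n) (fun _ => b) (fun _ => w)).symm

end CQChannel

/-- A secrecy code of length `n`: finite nonempty sets of secret messages `M`, public messages `L`
and keys `K`, a deterministic encoder, and for every key a measurement on `Bⁿ` with outcomes
in `M × L`. -/
structure SecrecyCode (n : ℕ) (b : Type*) [Fintype b] [DecidableEq b] where
  /-- secret messages -/
  M : Type
  /-- public messages -/
  L : Type
  /-- keys -/
  K : Type
  [fintypeM : Fintype M]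
  [fintypeL : Fintype L]
  [fintypeK : Fintype K]
  [nonemptyM : Nonempty M]
  [nonemptyL : Nonempty L]
  [nonemptyK : Nonempty K]
  /-- the encoder -/
  enc : M → L → K → Fin n → Fin 2
  /-- the decoding measurements -/
  dec : K → M × L → Matrix (Fin n → b) (Fin n → b) ℂ
  dec_posSemidef : ∀ k ml, (dec k ml).PosSemidef
  sum_dec : ∀ k, ∑ ml, dec k ml = 1

attribute [instance] SecrecyCode.fintypeM SecrecyCode.fintypeL SecrecyCode.fintypeK
  SecrecyCode.nonemptyM SecrecyCode.nonemptyL SecrecyCode.nonemptyK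

namespace SecrecyCode

variable {n : ℕ} {b w : Type*} [Fintype b] [DecidableEq b] [Fintype w]

/-- The joint output state for a secret message, a public message and a key. -/
def outState (C : SecrecyCode n b) (P : CQChannel b w) (m : C.M) (l : C.L) (k : C.K) :
    Matrix ((Fin n → b) × (Fin n → w)) ((Fin n → b) × (Fin n → w)) ℂ :=
  P.outSeq (C.enc m l k)

/-- The conditional probability of decoding error. -/
def errProb (C : SecrecyCode n b) (P : CQChannel b w) (m : C.M) (l : C.L) (k : C.K) : ℝ :=
  1 - (C.dec k (m, l) * trRight (C.outState P m l k)).trace.re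

/-- The average probability of decoding error, with uniform messages and key. -/
def avgErrProb (C : SecrecyCode n b) (P : CQChannel b w) : ℝ :=
  1 / ((Fintype.card C.M : ℝ) * Fintype.card C.L * Fintype.card C.K) *
    ∑ m, ∑ l, ∑ k, C.errProb P m l k

/-- Willie's state for a given secret message, averaged over public message and key. -/
def willieState (C : SecrecyCode n b) (P : CQChannel b w) (m : C.M) :
    Matrix (Fin n → w) (Fin n → w) ℂ :=
  (1 / ((Fintype.card C.L : ℂ) * Fintype.card C.K)) •
    ∑ l, ∑ k, trLeft (C.outState P m l k)

/-- Willie's state averaged over the secret message as well. -/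
def willieAvg (C : SecrecyCode n b) (P : CQChannel b w) :
    Matrix (Fin n → w) (Fin n → w) ℂ :=
  (1 / (Fintype.card C.M : ℂ)) • ∑ m, C.willieState P m

/-- The code is an `(|M|, |L|, |K|, n, ε, δcov, δsec)` secrecy code for `P`: it is reliable, covert
and secret. -/
structure IsCovertSecret [DecidableEq w] (C : SecrecyCode n b) (P : CQChannel b w)
    (ε δcov δsec : ℝ) : Prop where
  reliable : C.avgErrProb P ≤ ε
  covert : relEntropy (C.willieAvg P) (tensor fun _ => P.willie 0) ≤ (δcov : EReal)
  secret : ∃ ρ : Matrix (Fin n → w) (Fin n → w) ℂ, IsDensity ρ ∧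
    1 / (Fintype.card C.M : ℝ) * ∑ m, traceNorm (C.willieState P m - ρ) ≤ δsec

/-- The covert secret rate `log |M| / √(n δcov)`. -/
def secretRate (C : SecrecyCode n b) (δcov : ℝ) : ℝ :=
  Real.log (Fintype.card C.M) / √(n * δcov)

/-- The covert public rate `log |L| / √(n δcov)`. -/
def publicRate (C : SecrecyCode n b) (δcov : ℝ) : ℝ :=
  Real.log (Fintype.card C.L) / √(n * δcov)

/-- The covert key rate `log |K| / √(n δcov)`. -/
def keyRate (C : SecrecyCode n b) (δcov : ℝ) : ℝ :=
  Real.log (Fintype.card C.K) / √(n * δcov)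

end SecrecyCode

end

end CovertSecrecy

open CovertSecrecy

/-! Both ends of the channel are compared through one number, the average weight `N` of the
codewords, i.e. the expected number of non-innocent symbols.

Bob needs weight. Against the output of the innocent word, every decoding measurement finds the
right message with average probability `1 / (|M| |L|)`; against the true output it succeeds with
probability `1 - Pe`. Monotonicity of relative entropy under the binary test "correct or not", its
additivity and Fano's inequality give `(1 - Pe) log (|M| |L|) - h(Pe) ≤ N * D(σ₁‖σ₀)`
(`log_card_le_avgWeight_mul`).

Willie limits weight. The average divergence of his codeword states from the innocent state is `N *
D(ω₁‖ω₀)`. It splits into the divergence of the overall mixture (covertness, at most `δcov`), the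
Holevo information of the secret message (secrecy), and the entropy gap within each message, at most
`log (|L| |K|)` (`avgWeight_mul_le`). A continuity bound on the Holevo information that uses a
dimension would cost a term of order `n` times the secrecy distance, too much against `√(n δcov)`.
In `holevo_le` the factor is `log |M|` instead, so the secrecy term is `o(1) log |M| + o(1)`.

A zero public rate makes `log |L|` vanish, so eliminating `N` gives `log |K| ≥ (D(ω₁‖ω₀) / D(σ₁‖σ₀)
- o(1)) log |M|`. The additive errors are absorbed because a positive secret rate forces `|M| ≥ 2`.
Dividing by `√(n δcov)` and inserting the assumed secret rate cancels `D(σ₁‖σ₀)`; the chi-square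
divergence enters only as a common normalisation. -/

namespace CovertSecrecy

open Matrix

/-! ### Spectral decompositions, overlaps of eigenbases, entropy. -/

section Spectral

variable {d : Type*} [Fintype d] [DecidableEq d]

/-- `A = U diag(p) U†` with `U` unitary and `p` real. -/
structure IsSpectral (A U : Matrix d d ℂ) (p : d → ℝ) : Prop where
  star_mul : Uᴴ * U = 1
  mul_star : U * Uᴴ = 1
  eq : A = U * diagonal (fun i => (p i : ℂ)) * Uᴴ

/-- The squared overlaps `|⟨u_i, v_j⟩|²` of the columns of two matrices. -/
def overlap (U V : Matrix d d ℂ) (i j : d) : ℝ := Complex.normSq ((Uᴴ * V) i j)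

theorem exists_isSpectral {A : Matrix d d ℂ} (hA : A.IsHermitian) :
    ∃ U, IsSpectral A U hA.eigenvalues := by
  refine ⟨hA.eigenvectorUnitary, ?_, ?_, ?_⟩
  · exact (Matrix.mem_unitaryGroup_iff').1 hA.eigenvectorUnitary.2
  · exact (Matrix.mem_unitaryGroup_iff).1 hA.eigenvectorUnitary.2
  · conv_lhs => rw [hA.spectral_theorem]
    rfl

theorem exists_isSpectral_nonneg {A : Matrix d d ℂ} (hA : A.PosSemidef) :
    ∃ U p, IsSpectral A U p ∧ ∀ i, 0 ≤ p i :=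
  let ⟨U, hU⟩ := exists_isSpectral hA.isHermitian
  ⟨U, _, hU, hA.eigenvalues_nonneg⟩

theorem trace_diagonal_conj (a b : d → ℝ) (W : Matrix d d ℂ) :
    (diagonal (fun i => (a i : ℂ)) * W * diagonal (fun i => (b i : ℂ)) * Wᴴ).trace =
      ((∑ i, ∑ j, Complex.normSq (W i j) * (a i * b j) : ℝ) : ℂ) := by
  simp only [trace, diag_apply, Matrix.mul_apply (N := Wᴴ), mul_diagonal, diagonal_mul,
    conjTranspose_apply]
  push_cast
  refine Finset.sum_congr rfl fun i _ => Finset.sum_congr rfl fun j _ => ?_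
  rw [Complex.normSq_eq_conj_mul_self]
  simp only [RCLike.star_def]
  ring

namespace IsSpectral

variable {A B U V : Matrix d d ℂ} {p q : d → ℝ}

theorem isHermitian (h : IsSpectral A U p) : A.IsHermitian := by
  rw [h.eq]
  refine isHermitian_mul_mul_conjTranspose _ ?_
  simp [IsHermitian, diagonal_conjTranspose, Pi.star_def]

theorem map (h : IsSpectral A U p) (f : ℝ → ℝ) :
    IsSpectral (U * diagonal (fun i => (f (p i) : ℂ)) * Uᴴ) U (fun i => f (p i)) :=
  ⟨h.star_mul, h.mul_star, rfl⟩

theorem aeval_eq (h : IsSpectral A U p) (q : Polynomial ℝ) :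
    Polynomial.aeval A q = U * diagonal (fun i => ((q.eval (p i) : ℝ) : ℂ)) * Uᴴ := by
  induction q using Polynomial.induction_on' with
  | add q r hq hr =>
    rw [map_add, hq, hr, ← add_mul, ← mul_add, diagonal_add]
    simp
  | monomial n a =>
    have hpow : A ^ n = U * diagonal (fun i => ((p i ^ n : ℝ) : ℂ)) * Uᴴ := by
      induction n with
      | zero => simp [h.mul_star]
      | succ n ih =>
        rw [pow_succ, ih, h.eq]
        calc _ = U * diagonal (fun i => ((p i ^ n : ℝ) : ℂ)) * (Uᴴ * U) *
              diagonal (fun i => (p i : ℂ)) * Uᴴ := by simp only [Matrix.mul_assoc]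
          _ = _ := by
            rw [h.star_mul, Matrix.mul_one, Matrix.mul_assoc U, diagonal_mul_diagonal]
            simp [pow_succ]
    rw [Polynomial.aeval_monomial, hpow, Algebra.algebraMap_eq_smul_one, smul_mul_assoc, one_mul]
    have : diagonal (fun i => (((Polynomial.monomial n a).eval (p i) : ℝ) : ℂ)) =
        a • diagonal (fun i => ((p i ^ n : ℝ) : ℂ)) := by
      ext i j
      by_cases hij : i = j
      · subst hij; simp
      · simp [hij]
    rw [this, Matrix.mul_smul, Matrix.smul_mul]

/-- On finitely many points `f` is a polynomial, and polynomials of `A` can be computed in any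
diagonalisation, not only a canonical one. -/
theorem cfc_eq (h : IsSpectral A U p) (f : ℝ → ℝ) :
    cfc f A = U * diagonal (fun i => (f (p i) : ℂ)) * Uᴴ := by
  classical
  -- Interpolating on the spectrum and on the values of `p` together avoids proving that these sets
  -- agree.
  set s : Finset ℝ := (Matrix.finite_real_spectrum (A := A)).toFinset ∪ Finset.univ.image p
  set q := Lagrange.interpolate s id f
  have hq : ∀ x ∈ s, q.eval x = f x := fun x hx =>
    Lagrange.eval_interpolate_at_node (v := id) f (Function.injective_id.injOn) hx
  have h1 : cfc f A = cfc (fun x => q.eval x) A := by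
    refine cfc_congr fun x hx => (hq x ?_).symm
    simp [s, hx]
  have hA : IsSelfAdjoint A := h.isHermitian
  rw [h1, cfc_polynomial q A hA, h.aeval_eq]
  congr 3
  funext i
  rw [hq]
  simp [s]

theorem isSpectral_cfc (h : IsSpectral A U p) (f : ℝ → ℝ) :
    IsSpectral (cfc f A) U (fun i => f (p i)) := by
  rw [h.cfc_eq]; exact h.map f

theorem posSemidef (h : IsSpectral A U p) (hp : ∀ i, 0 ≤ p i) : A.PosSemidef := by
  rw [h.eq]
  refine PosSemidef.mul_mul_conjTranspose_same (PosSemidef.diagonal ?_) _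
  intro i
  simpa using hp i

theorem trace_eq (h : IsSpectral A U p) : A.trace = ((∑ i, p i : ℝ) : ℂ) := by
  rw [h.eq, trace_mul_comm, ← Matrix.mul_assoc, h.star_mul, Matrix.one_mul]
  simp [trace]

theorem trace_mul_eq (hA : IsSpectral A U p) (hB : IsSpectral B V q) :
    (A * B).trace = ((∑ i, ∑ j, overlap U V i j * (p i * q j) : ℝ) : ℂ) := by
  rw [hA.eq, hB.eq]
  have : (U * diagonal (fun i => (p i : ℂ)) * Uᴴ * (V * diagonal (fun i => (q i : ℂ)) * Vᴴ)).trace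
      = (diagonal (fun i => (p i : ℂ)) * (Uᴴ * V) * diagonal (fun i => (q i : ℂ)) *
        (Uᴴ * V)ᴴ).trace := by
    rw [Matrix.mul_assoc, Matrix.mul_assoc, trace_mul_comm]
    simp only [conjTranspose_mul, conjTranspose_conjTranspose, Matrix.mul_assoc]
  rw [this, trace_diagonal_conj]
  rfl

/-- Unitarity of `Uᴴ * V`. The overlaps of two eigenbases are thus doubly stochastic, which turns
traces of two operators into classical averages. -/
theorem sum_overlap_right (hU : IsSpectral A U p) (hV : IsSpectral B V q) (i : d) :
    ∑ j, overlap U V i j = 1 := by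
  have h : ((Uᴴ * V) * (Uᴴ * V)ᴴ) i i = 1 := by
    rw [conjTranspose_mul, conjTranspose_conjTranspose, Matrix.mul_assoc, ← Matrix.mul_assoc V,
      hV.mul_star, Matrix.one_mul, hU.star_mul, one_apply_eq]
  rw [Matrix.mul_apply] at h
  have h2 : ((∑ j, overlap U V i j : ℝ) : ℂ) = 1 := by
    rw [← h]
    push_cast
    refine Finset.sum_congr rfl fun j _ => ?_
    rw [overlap, conjTranspose_apply, RCLike.star_def, Complex.mul_conj]
  exact_mod_cast h2

end IsSpectral

omit [DecidableEq d] in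
theorem overlap_symm (U V : Matrix d d ℂ) (i j : d) : overlap U V i j = overlap V U j i := by
  have : (Uᴴ * V) i j = star ((Vᴴ * U) j i) := by
    rw [← conjTranspose_apply, conjTranspose_mul, conjTranspose_conjTranspose]
  rw [overlap, this, RCLike.star_def, Complex.normSq_conj, overlap]

omit [DecidableEq d] in
theorem overlap_nonneg (U V : Matrix d d ℂ) (i j : d) : 0 ≤ overlap U V i j :=
  Complex.normSq_nonneg _

theorem IsSpectral.sum_overlap_left {A B U V : Matrix d d ℂ} {p q : d → ℝ}
    (hU : IsSpectral A U p) (hV : IsSpectral B V q) (j : d) :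
    ∑ i, overlap U V i j = 1 := by
  simp_rw [overlap_symm U V]
  exact hV.sum_overlap_right hU j

/-- `Tr[A log A]`, minus the von Neumann entropy. -/
noncomputable def negEntropy (A : Matrix d d ℂ) : ℝ := (A * logOp A).trace.re

theorem IsSpectral.negEntropy_eq {A U : Matrix d d ℂ} {p : d → ℝ} (h : IsSpectral A U p) :
    negEntropy A = ∑ i, p i * Real.log (p i) := by
  have h2 : A * logOp A = U * diagonal (fun i => ((p i * Real.log (p i) : ℝ) : ℂ)) * Uᴴ := by
    rw [logOp, h.cfc_eq]
    conv_lhs => rw [h.eq]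
    calc _ = U * diagonal (fun i => (p i : ℂ)) * (Uᴴ * U) *
              diagonal (fun i => (Real.log (p i) : ℂ)) * Uᴴ := by simp only [Matrix.mul_assoc]
      _ = _ := by
        rw [h.star_mul, Matrix.mul_one, Matrix.mul_assoc U, diagonal_mul_diagonal]
        simp
  rw [negEntropy, h2, (h.map fun x => x * Real.log x).trace_eq, Complex.ofReal_re]

end Spectral

/-- The tangent bound `log z ≤ z - 1` at `z = X y_i / (Y x_i)`, weighted by `x_i`; the linear terms
cancel after summation. -/
theorem log_sum_inequality {ι : Type*} (s : Finset ι) (x y : ι → ℝ) (hx : ∀ i ∈ s, 0 ≤ x i)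
    (hy : ∀ i ∈ s, 0 ≤ y i) (hxy : ∀ i ∈ s, y i = 0 → x i = 0) :
    (∑ i ∈ s, x i) * (Real.log (∑ i ∈ s, x i) - Real.log (∑ i ∈ s, y i)) ≤
      ∑ i ∈ s, x i * (Real.log (x i) - Real.log (y i)) := by
  set X := ∑ i ∈ s, x i
  set Y := ∑ i ∈ s, y i
  rcases (Finset.sum_nonneg hx).eq_or_lt with hX | hX
  · have h0 : ∀ i ∈ s, x i = 0 := (Finset.sum_eq_zero_iff_of_nonneg hx).1 hX.symm
    have : X = 0 := hX.symm
    rw [this, zero_mul]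
    refine Finset.sum_nonneg fun i hi => ?_
    rw [h0 i hi, zero_mul]
  have hY : 0 < Y := by
    refine (Finset.sum_nonneg hy).lt_of_ne fun h => hX.ne ?_
    have h0 : ∀ i ∈ s, y i = 0 := (Finset.sum_eq_zero_iff_of_nonneg hy).1 h.symm
    exact (Finset.sum_eq_zero fun i hi => hxy i hi (h0 i hi)).symm
  have hX : 0 < X := hX
  have key : ∀ i ∈ s, x i - X * y i / Y + x i * (Real.log X - Real.log Y) ≤
      x i * (Real.log (x i) - Real.log (y i)) := by
    intro i hi
    rcases (hx i hi).eq_or_lt with h0 | hpos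
    · rw [← h0]
      have : 0 ≤ X * y i / Y := by have := hy i hi; positivity
      linarith
    have hyi : 0 < y i := (hy i hi).lt_of_ne fun h => hpos.ne' (hxy i hi h.symm)
    have h1 := Real.log_le_sub_one_of_pos (x := X * y i / (Y * x i)) (by positivity)
    rw [Real.log_div (by positivity) (by positivity), Real.log_mul hX.ne' hyi.ne',
      Real.log_mul hY.ne' hpos.ne'] at h1
    have h2 : x i * (X * y i / (Y * x i)) = X * y i / Y := by field_simp
    nlinarith [mul_le_mul_of_nonneg_left h1 hpos.le]
  have h := Finset.sum_le_sum key
  rw [Finset.sum_add_distrib, Finset.sum_sub_distrib, ← Finset.sum_mul, ← Finset.sum_div,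
    ← Finset.mul_sum] at h
  change X - X * Y / Y + X * _ ≤ _ at h
  rw [mul_div_cancel_right₀ _ hY.ne'] at h
  linarith

/-! ### Convexity and near-additivity of `Tr[A log A]`. -/

section TraceInequalities

variable {d : Type*} [Fintype d] [DecidableEq d]

/-- The (real) diagonal entries of `A` in the basis of the columns of `U`. -/
def diagEntry (U A : Matrix d d ℂ) (i : d) : ℝ := ((Uᴴ * A * U) i i).re

omit [DecidableEq d] in
theorem diagEntry_add (U A B : Matrix d d ℂ) (i : d) :
    diagEntry U (A + B) i = diagEntry U A i + diagEntry U B i := by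
  simp [diagEntry, Matrix.mul_add, Matrix.add_mul]

omit [DecidableEq d] in
theorem diagEntry_sub (U A B : Matrix d d ℂ) (i : d) :
    diagEntry U (A - B) i = diagEntry U A i - diagEntry U B i := by
  simp [diagEntry, Matrix.mul_sub, Matrix.sub_mul]

omit [DecidableEq d] in
theorem diagEntry_sum_smul {ι : Type*} (s : Finset ι) (w : ι → ℝ) (U : Matrix d d ℂ)
    (A : ι → Matrix d d ℂ) (i : d) :
    diagEntry U (∑ m ∈ s, (w m : ℂ) • A m) i = ∑ m ∈ s, w m * diagEntry U (A m) i := by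
  simp [diagEntry, Matrix.mul_sum, Matrix.sum_mul, Matrix.sum_apply]

omit [DecidableEq d] in
theorem diagEntry_nonneg (U : Matrix d d ℂ) {A : Matrix d d ℂ} (hA : A.PosSemidef) (i : d) :
    0 ≤ diagEntry U A i := by
  have := (hA.conjTranspose_mul_mul_same U).diag_nonneg (i := i)
  exact (Complex.le_def.1 this).1

variable {A B U V : Matrix d d ℂ} {p q : d → ℝ}

theorem IsSpectral.diagEntry_eq_sum (hV : IsSpectral A V q) (U : Matrix d d ℂ) (i : d) :
    diagEntry U A i = ∑ j, overlap U V i j * q j := by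
  have h : Uᴴ * A * U = (Uᴴ * V) * diagonal (fun i => (q i : ℂ)) * (Uᴴ * V)ᴴ := by
    rw [hV.eq, conjTranspose_mul, conjTranspose_conjTranspose]
    simp only [Matrix.mul_assoc]
  rw [diagEntry, h, Matrix.mul_apply, Complex.re_sum]
  refine Finset.sum_congr rfl fun j _ => ?_
  rw [mul_diagonal, conjTranspose_apply, mul_right_comm, RCLike.star_def, Complex.mul_conj, overlap,
    ← Complex.ofReal_mul, Complex.ofReal_re]

theorem IsSpectral.diagEntry_self (hU : IsSpectral A U p) (i : d) : diagEntry U A i = p i := by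
  have h : Uᴴ * A * U = diagonal (fun i => (p i : ℂ)) := by
    rw [hU.eq]
    calc _ = (Uᴴ * U) * diagonal (fun i => (p i : ℂ)) * (Uᴴ * U) := by
          simp only [Matrix.mul_assoc]
      _ = _ := by rw [hU.star_mul, Matrix.one_mul, Matrix.mul_one]
  rw [diagEntry, h, diagonal_apply_eq, Complex.ofReal_re]

theorem IsSpectral.sum_diagEntry (hU : IsSpectral A U p) (B : Matrix d d ℂ) :
    ∑ i, diagEntry U B i = B.trace.re := by
  have h : (Uᴴ * B * U).trace = B.trace := by
    rw [trace_mul_comm, ← Matrix.mul_assoc, hU.mul_star, Matrix.one_mul]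
  rw [← h, trace, Complex.re_sum]
  rfl

/-- Peierls' inequality for `x log x`. -/
theorem IsSpectral.sum_diagEntry_mul_log_le (hU : IsSpectral A U p) (hB : B.PosSemidef) :
    ∑ i, diagEntry U B i * Real.log (diagEntry U B i) ≤ negEntropy B := by
  obtain ⟨V, q, hV, hq⟩ := exists_isSpectral_nonneg hB
  rw [hV.negEntropy_eq]
  calc _ ≤ ∑ i, ∑ j, overlap U V i j * (q j * Real.log (q j)) := by
        refine Finset.sum_le_sum fun i _ => ?_
        rw [hV.diagEntry_eq_sum]
        exact Real.convexOn_mul_log.map_sum_le (fun j _ => overlap_nonneg U V i j)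
          (hU.sum_overlap_right hV i) (fun j _ => hq j)
    _ = _ := by
        rw [Finset.sum_comm]
        refine Finset.sum_congr rfl fun j _ => ?_
        rw [← Finset.sum_mul, hU.sum_overlap_left hV, one_mul]

omit [Fintype d] [DecidableEq d] in
theorem posSemidef_sum_smul {ι : Type*} [Fintype ι] {w : ι → ℝ} (hw : ∀ m, 0 ≤ w m)
    {A : ι → Matrix d d ℂ} (hA : ∀ m, (A m).PosSemidef) :
    (∑ m, (w m : ℂ) • A m).PosSemidef :=
  posSemidef_sum _ fun m _ => (hA m).smul (by exact_mod_cast hw m)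

/-- In the eigenbasis of the mixture this is scalar convexity of `x log x` on diagonal entries;
Peierls' inequality returns to the operators. -/
theorem negEntropy_sum_smul_le {ι : Type*} [Fintype ι] {w : ι → ℝ} (hw : ∀ m, 0 ≤ w m)
    (hw1 : ∑ m, w m = 1) {A : ι → Matrix d d ℂ} (hA : ∀ m, (A m).PosSemidef) :
    negEntropy (∑ m, (w m : ℂ) • A m) ≤ ∑ m, w m * negEntropy (A m) := by
  obtain ⟨U, p, hU, hp⟩ := exists_isSpectral_nonneg (posSemidef_sum_smul hw hA)
  rw [hU.negEntropy_eq]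
  calc _ ≤ ∑ i, ∑ m, w m * (diagEntry U (A m) i * Real.log (diagEntry U (A m) i)) := by
        refine Finset.sum_le_sum fun i _ => ?_
        rw [← hU.diagEntry_self i, diagEntry_sum_smul]
        exact Real.convexOn_mul_log.map_sum_le (fun m _ => hw m) hw1
          (fun m _ => diagEntry_nonneg U (hA m) i)
    _ = ∑ m, w m * ∑ i, diagEntry U (A m) i * Real.log (diagEntry U (A m) i) := by
        rw [Finset.sum_comm]
        simp_rw [Finset.mul_sum]
    _ ≤ _ := Finset.sum_le_sum fun m _ =>
        mul_le_mul_of_nonneg_left (hU.sum_diagEntry_mul_log_le (hA m)) (hw m)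

/-- In the eigenbasis of `A + B`, the log-sum inequality compares each diagonal with the spectrum of
the sum. The correction depends on the traces alone, hence not on the dimension. -/
theorem negEntropy_add_le (hA : A.PosSemidef) (hB : B.PosSemidef) :
    negEntropy (A + B) ≤ negEntropy A + negEntropy B +
      ((A.trace.re + B.trace.re) * Real.log (A.trace.re + B.trace.re) -
        A.trace.re * Real.log A.trace.re - B.trace.re * Real.log B.trace.re) := by
  obtain ⟨U, p, hU, hp⟩ := exists_isSpectral_nonneg (hA.add hB)
  have hpeq : ∀ i, p i = diagEntry U A i + diagEntry U B i := fun i => by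
    rw [← hU.diagEntry_self i, diagEntry_add]
  have ha := diagEntry_nonneg U hA
  have hb := diagEntry_nonneg U hB
  have h1 := log_sum_inequality Finset.univ (diagEntry U A) p (fun i _ => ha i) (fun i _ => hp i)
    (fun i _ h => by linarith [hpeq i, ha i, hb i])
  have h2 := log_sum_inequality Finset.univ (diagEntry U B) p (fun i _ => hb i) (fun i _ => hp i)
    (fun i _ h => by linarith [hpeq i, ha i, hb i])
  have h3 := hU.sum_diagEntry_mul_log_le hA
  have h4 := hU.sum_diagEntry_mul_log_le hB
  have hsum : ∑ i, p i = A.trace.re + B.trace.re := by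
    simp_rw [hpeq, Finset.sum_add_distrib, hU.sum_diagEntry]
  rw [hsum, hU.sum_diagEntry] at h1 h2
  have h5 : ∑ i, p i * Real.log (p i) = ∑ i, diagEntry U A i * Real.log (p i) +
      ∑ i, diagEntry U B i * Real.log (p i) := by
    rw [← Finset.sum_add_distrib]
    refine Finset.sum_congr rfl fun i _ => ?_
    rw [← add_mul, ← hpeq]
  simp_rw [mul_sub, Finset.sum_sub_distrib] at h1 h2
  rw [hU.negEntropy_eq, h5]
  linarith

/-- With `Z` the pseudo-inverse of `B`, the bound `A ≤ B` gives `Z A Z ≤ Z B Z = Z`. At the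
eigenvector `u_i` of `A`, with `S = ⟨u_i, Z u_i⟩`, this reads `p_i S² ≤ S`. -/
theorem IsSpectral.mul_sum_overlap_div_le (hU : IsSpectral A U p) (hp : ∀ i, 0 ≤ p i)
    (hV : IsSpectral B V q) (hq : ∀ i, 0 ≤ q i) (hAB : (B - A).PosSemidef) (i : d) :
    p i * ∑ j, overlap U V i j * (q j)⁻¹ ≤ 1 := by
  set Z := V * diagonal (fun j => ((q j)⁻¹ : ℂ)) * Vᴴ with hZ
  have hZs : IsSpectral Z V (fun j => (q j)⁻¹) := by
    have := hV.map (fun x => x⁻¹)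
    simpa [hZ] using this
  have hZZ : Z * B * Z = Z := by
    conv_lhs => rw [hZ, hV.eq]
    calc _ = V * diagonal (fun j => ((q j)⁻¹ : ℂ)) * (Vᴴ * V) * diagonal (fun j => (q j : ℂ)) *
          (Vᴴ * V) * diagonal (fun j => ((q j)⁻¹ : ℂ)) * Vᴴ := by simp only [Matrix.mul_assoc]
      _ = _ := by
        rw [hV.star_mul, Matrix.mul_one, Matrix.mul_one, Matrix.mul_assoc V, diagonal_mul_diagonal,
          Matrix.mul_assoc V, diagonal_mul_diagonal]
        congr 3
        funext j
        by_cases h : q j = 0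
        · simp [h]
        · have : (q j : ℂ) ≠ 0 := by exact_mod_cast h
          field_simp
  set S := ∑ j, overlap U V i j * (q j)⁻¹ with hS
  have hS0 : 0 ≤ S := Finset.sum_nonneg fun j _ =>
    mul_nonneg (overlap_nonneg _ _ _ _) (inv_nonneg.2 (hq j))
  have h1 := diagEntry_nonneg (Z * U) hAB i
  have hZH : Zᴴ = Z := hZs.isHermitian
  have h2 : diagEntry (Z * U) B i = S := by
    rw [diagEntry, conjTranspose_mul, hZH]
    have : Uᴴ * Z * B * (Z * U) = Uᴴ * (Z * B * Z) * U := by simp only [Matrix.mul_assoc]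
    rw [this, hZZ]
    exact hZs.diagEntry_eq_sum U i
  -- Only the `i`-th spectral term of `A` is kept; the others are nonnegative.
  have h3 : p i * S ^ 2 ≤ diagEntry (Z * U) A i := by
    rw [hU.diagEntry_eq_sum]
    have h4 : overlap (Z * U) U i i = S ^ 2 := by
      rw [overlap, conjTranspose_mul, hZH]
      have h5 : ((Uᴴ * Z * U) i i).re = S := hZs.diagEntry_eq_sum U i
      have h6 : ((Uᴴ * Z * U) i i).im = 0 := by
        have hH : (Uᴴ * Z * U).IsHermitian := isHermitian_conjTranspose_mul_mul U hZs.isHermitian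
        have := hH.apply i i
        exact Complex.conj_eq_iff_im.1 this
      rw [Complex.normSq_apply, h5, h6]
      ring
    rw [mul_comm, ← h4]
    exact Finset.single_le_sum (f := fun j => overlap (Z * U) U i j * p j)
      (fun j _ => mul_nonneg (overlap_nonneg _ _ _ _) (hp j)) (Finset.mem_univ i)
  rw [diagEntry_sub, h2] at h1
  rcases hS0.eq_or_lt with h0 | hpos
  · rw [← h0]; simp
  · have : p i * S ^ 2 ≤ S := by linarith
    by_contra! hcon
    nlinarith

/-- Monotonicity of the logarithm, tested against the smaller operator. -/
theorem IsSpectral.negEntropy_le_sum (hU : IsSpectral A U p) (hp : ∀ i, 0 ≤ p i)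
    (hV : IsSpectral B V q) (hq : ∀ i, 0 ≤ q i) (hAB : (B - A).PosSemidef) :
    negEntropy A ≤ ∑ i, ∑ j, overlap U V i j * (p i * Real.log (q j)) := by
  rw [hU.negEntropy_eq]
  refine Finset.sum_le_sum fun i _ => ?_
  -- The kernel of `B` lies in that of `A`, so the convention `log 0 = 0` does no harm.
  have hzero : ∀ j, q j = 0 → overlap U V i j * p i = 0 := by
    intro j hj
    have h1 := diagEntry_nonneg V hAB j
    rw [diagEntry_sub, hV.diagEntry_self, hj, hU.diagEntry_eq_sum] at h1
    have h2 := Finset.single_le_sum (f := fun i => overlap V U j i * p i)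
      (fun i _ => mul_nonneg (overlap_nonneg _ _ _ _) (hp i)) (Finset.mem_univ i)
    rw [overlap_symm]
    exact le_antisymm (by linarith) (mul_nonneg (overlap_nonneg _ _ _ _) (hp i))
  -- This is `log (q / p) ≥ 1 - p / q`; the summed error `p_i (1 - p_i S)`, with `S = ∑ j, overlap U
  -- V i j * (q j)⁻¹`, is nonnegative by `mul_sum_overlap_div_le`.
  have key : ∀ j, overlap U V i j * (p i * Real.log (p i)) +
      p i * (overlap U V i j - p i * (overlap U V i j * (q j)⁻¹)) ≤
      overlap U V i j * (p i * Real.log (q j)) := by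
    intro j
    rcases (hp i).eq_or_lt with h0 | hpi
    · simp [← h0]
    rcases (hq j).eq_or_lt with h0 | hqj
    · have := hzero j h0.symm
      rcases mul_eq_zero.1 this with h | h
      · simp [h]
      · exact absurd h hpi.ne'
    have h1 := Real.log_le_sub_one_of_pos (x := p i / q j) (by positivity)
    rw [Real.log_div hpi.ne' hqj.ne'] at h1
    have h2 := mul_le_mul_of_nonneg_left h1 (mul_nonneg (overlap_nonneg U V i j) hpi.le)
    rw [div_eq_mul_inv] at h2
    linarith
  have h := Finset.sum_le_sum fun j (_ : j ∈ Finset.univ) => key j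
  rw [Finset.sum_add_distrib, ← Finset.sum_mul, hU.sum_overlap_right hV, one_mul, ← Finset.mul_sum,
    Finset.sum_sub_distrib, hU.sum_overlap_right hV, ← Finset.mul_sum] at h
  have h1 := hU.mul_sum_overlap_div_le hp hV hq hAB i
  have := mul_nonneg (hp i) (sub_nonneg.2 h1)
  linarith

/-- Split `Tr[(A + B) log (A + B)]` linearly and use that the logarithm of `A + B`, tested against
`A` or `B`, dominates their own. -/
theorem negEntropy_add_ge (hA : A.PosSemidef) (hB : B.PosSemidef) :
    negEntropy A + negEntropy B ≤ negEntropy (A + B) := by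
  obtain ⟨U, p, hU, hp⟩ := exists_isSpectral_nonneg hA
  obtain ⟨V, q, hV, hq⟩ := exists_isSpectral_nonneg hB
  obtain ⟨W, r, hW, hr⟩ := exists_isSpectral_nonneg (hA.add hB)
  have h1 := hU.negEntropy_le_sum hp hW hr (by rwa [add_sub_cancel_left])
  have h2 := hV.negEntropy_le_sum hq hW hr (by rwa [add_sub_cancel_right])
  have hlog := hW.isSpectral_cfc Real.log
  have e1 := congrArg Complex.re (hU.trace_mul_eq hlog)
  have e2 := congrArg Complex.re (hV.trace_mul_eq hlog)
  rw [Complex.ofReal_re] at e1 e2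
  rw [← e1] at h1
  rw [← e2] at h2
  have : negEntropy (A + B) = (A * cfc Real.log (A + B)).trace.re +
      (B * cfc Real.log (A + B)).trace.re := by
    rw [negEntropy, logOp, Matrix.add_mul, trace_add, Complex.add_re]
  linarith

theorem negEntropy_zero : negEntropy (0 : Matrix d d ℂ) = 0 := by simp [negEntropy]

theorem sum_negEntropy_le {ι : Type*} (s : Finset ι) {A : ι → Matrix d d ℂ}
    (hA : ∀ m, (A m).PosSemidef) :
    ∑ m ∈ s, negEntropy (A m) ≤ negEntropy (∑ m ∈ s, A m) := by
  classical
  induction s using Finset.induction_on with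
  | empty => simp [negEntropy_zero]
  | insert a s ha ih =>
    rw [Finset.sum_insert ha, Finset.sum_insert ha]
    have := negEntropy_add_ge (hA a) (posSemidef_sum s fun m _ => hA m)
    linarith

theorem IsSpectral.smul (hU : IsSpectral A U p) (c : ℝ) :
    IsSpectral ((c : ℂ) • A) U (fun i => c * p i) := by
  refine ⟨hU.star_mul, hU.mul_star, ?_⟩
  have : diagonal (fun i => ((c * p i : ℝ) : ℂ)) = (c : ℂ) • diagonal (fun i => (p i : ℂ)) := by
    rw [← diagonal_smul]
    congr 1
    funext i
    simp
  rw [this, Matrix.mul_smul, Matrix.smul_mul, ← hU.eq]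

theorem negEntropy_smul (hA : A.PosSemidef) {c : ℝ} (hc : 0 < c) :
    negEntropy ((c : ℂ) • A) = c * negEntropy A + c * Real.log c * A.trace.re := by
  obtain ⟨U, p, hU, hp⟩ := exists_isSpectral_nonneg hA
  rw [(hU.smul c).negEntropy_eq, hU.negEntropy_eq, hU.trace_eq, Complex.ofReal_re, Finset.mul_sum,
    Finset.mul_sum, ← Finset.sum_add_distrib]
  refine Finset.sum_congr rfl fun i _ => ?_
  rcases (hp i).eq_or_lt with h0 | hpi
  · simp [← h0]
  · rw [Real.log_mul hc.ne' hpi.ne']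
    ring

/-- The gap in the convexity of `Tr[A log A]` is at most the logarithm of the number of terms. -/
theorem avg_negEntropy_le {ι : Type*} [Fintype ι] [Nonempty ι] {A : ι → Matrix d d ℂ}
    (hA : ∀ m, (A m).PosSemidef) :
    1 / (Fintype.card ι : ℝ) * ∑ m, negEntropy (A m) ≤
      negEntropy ((1 / (Fintype.card ι : ℂ)) • ∑ m, A m) +
        1 / (Fintype.card ι : ℝ) * (∑ m, (A m).trace.re) * Real.log (Fintype.card ι) := by
  have hc : 0 < 1 / (Fintype.card ι : ℝ) := by positivity
  have h := sum_negEntropy_le Finset.univ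
    (fun m => (hA m).smul (by exact_mod_cast hc.le : (0 : ℂ) ≤ ((1 / (Fintype.card ι : ℝ) : ℝ) : ℂ)))
  simp_rw [negEntropy_smul (hA _) hc] at h
  rw [Finset.sum_add_distrib, ← Finset.mul_sum, ← Finset.mul_sum, ← Finset.smul_sum, one_div,
    Real.log_inv] at h
  push_cast at h
  rw [one_div, one_div]
  linarith

end TraceInequalities

/-! ### Monotonicity of relative entropy under measurements. -/

section Measurement

/-- Relative entropy is recovered by integrating the resolvent divergence `p² / (q + t p)` over `t`;
the three lemmas here give the integrand and its two boundary limits. -/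
theorem hasDerivAt_mul_log_add {p q t : ℝ} (hp : 0 ≤ p) (hq : 0 ≤ q) (ht : 0 < t) :
    HasDerivAt (fun t => p * Real.log (q + t * p)) (p ^ 2 / (q + t * p)) t := by
  rcases hp.eq_or_lt with h0 | hp
  · subst h0
    simpa using hasDerivAt_const t (0 : ℝ)
  have hpos : q + t * p ≠ 0 := by positivity
  have h1 : HasDerivAt (fun t => q + t * p) p t := by
    simpa using ((hasDerivAt_id t).mul_const p).const_add q
  exact ((h1.log hpos).const_mul p).congr_deriv (by rw [pow_two, mul_div_assoc])

theorem tendsto_mul_log_add_zero {p q : ℝ} (h : p ≠ 0 → q ≠ 0) :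
    Tendsto (fun t => p * Real.log (q + t * p)) (𝓝[>] 0) (𝓝 (p * Real.log q)) := by
  rcases eq_or_ne p 0 with h0 | hp
  · simp [h0]
  have h1 : Tendsto (fun t : ℝ => q + t * p) (𝓝[>] 0) (𝓝 q) := by
    have : Continuous fun t : ℝ => q + t * p := by fun_prop
    simpa using (this.tendsto 0).mono_left nhdsWithin_le_nhds
  exact (h1.log (h hp)).const_mul p

theorem tendsto_mul_log_add_atTop {p q : ℝ} (hp : 0 ≤ p) (hq : 0 ≤ q) :
    Tendsto (fun t => p * Real.log (q + t * p) - p * Real.log t) atTop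
      (𝓝 (p * Real.log p)) := by
  rcases hp.eq_or_lt with h0 | hp
  · simp [← h0]
  have h1 : Tendsto (fun t : ℝ => q / t + p) atTop (𝓝 p) := by
    simpa using (tendsto_const_nhds.div_atTop tendsto_id).add_const p
  refine ((h1.log hp.ne').const_mul p).congr' ?_
  filter_upwards [eventually_gt_atTop 0] with t ht
  have : q + t * p = t * (q / t + p) := by field_simp
  rw [this, Real.log_mul ht.ne' (by positivity)]
  ring

/-- A comparison of the resolvent divergences `∑ p² / (q + t p)` for all `t > 0` implies one of the
relative entropies. -/
theorem relEntropy_le_of_resolvent_le {ι κ : Type*} [Fintype ι] [Fintype κ] {c p q : ι → ℝ}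
    {P Q : κ → ℝ} (hc : ∀ i, 0 ≤ c i) (hp : ∀ i, 0 ≤ p i) (hq : ∀ i, 0 ≤ q i) (hP : ∀ k, 0 ≤ P k)
    (hQ : ∀ k, 0 ≤ Q k) (hcpq : ∀ i, c i * p i ≠ 0 → q i ≠ 0) (hsum : ∑ i, c i * p i = ∑ k, P k)
    (h : ∀ t : ℝ, 0 < t →
      ∑ k, P k ^ 2 / (Q k + t * P k) ≤ ∑ i, c i * (p i ^ 2 / (q i + t * p i))) :
    (∀ k, Q k = 0 → P k = 0) ∧
      ∑ k, P k * (Real.log (P k) - Real.log (Q k)) ≤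
        ∑ i, c i * (p i * (Real.log (p i) - Real.log (q i))) := by
  have hzero : ∀ k, Q k = 0 → P k = 0 := by
    intro k hk
    by_contra hPk
    have hPk : 0 < P k := (hP k).lt_of_ne' hPk
    -- `K` bounds the right side uniformly in `t`, whereas a term with `Q k = 0 < P k` would
    -- contribute `P k / t`, unbounded as `t → 0`.
    set K := ∑ i, c i * (p i ^ 2 / q i)
    have hK : 0 ≤ K := Finset.sum_nonneg fun i _ =>
      mul_nonneg (hc i) (div_nonneg (sq_nonneg _) (hq i))
    have hle : ∀ t : ℝ, 0 < t → P k ≤ t * K := by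
      intro t ht
      have h1 : P k ^ 2 / (Q k + t * P k) ≤ ∑ k, P k ^ 2 / (Q k + t * P k) :=
        Finset.single_le_sum (f := fun k => P k ^ 2 / (Q k + t * P k))
          (fun k _ => div_nonneg (sq_nonneg _)
            (add_nonneg (hQ k) (mul_nonneg ht.le (hP k)))) (Finset.mem_univ k)
      have h2 : ∑ i, c i * (p i ^ 2 / (q i + t * p i)) ≤ K := by
        refine Finset.sum_le_sum fun i _ => ?_
        by_cases hcp : c i * p i = 0
        · rcases mul_eq_zero.1 hcp with h0 | h0 <;> simp [h0]
        have hqi : 0 < q i := (hq i).lt_of_ne' (hcpq i hcp)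
        have := mul_nonneg ht.le (hp i)
        have := hc i
        gcongr
        linarith
      have h3 : P k ^ 2 / (Q k + t * P k) = P k / t := by
        rw [hk]; field_simp; ring
      have h4 : P k / t ≤ K := by linarith [h t ht]
      rwa [div_le_iff₀ ht, mul_comm] at h4
    have h1 := hle (P k / (2 * (K + 1))) (by positivity)
    have h2 : P k / (2 * (K + 1)) * K = P k * (K / (2 * (K + 1))) := by ring
    have h3 : K / (2 * (K + 1)) < 1 := by rw [div_lt_one (by positivity)]; linarith
    nlinarith
  refine ⟨hzero, ?_⟩
  -- The hypothesis says that `Φ` increases. At infinity the `log t` terms cancel by equality of the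
  -- masses, and the limits at `0` and `∞` differ by exactly the difference of the two divergences.
  set Φ : ℝ → ℝ := fun t => ∑ i, c i * (p i * Real.log (q i + t * p i)) -
    ∑ k, P k * Real.log (Q k + t * P k) with hΦ
  have hderiv : ∀ t : ℝ, 0 < t → HasDerivAt Φ
      (∑ i, c i * (p i ^ 2 / (q i + t * p i)) - ∑ k, P k ^ 2 / (Q k + t * P k)) t := fun t ht =>
    (HasDerivAt.fun_sum fun i _ => (hasDerivAt_mul_log_add (hp i) (hq i) ht).const_mul (c i)).sub
      (HasDerivAt.fun_sum fun k _ => hasDerivAt_mul_log_add (hP k) (hQ k) ht)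
  have hmono : MonotoneOn Φ (Set.Ioi 0) := by
    refine monotoneOn_of_deriv_nonneg (convex_Ioi 0)
      (fun t ht => (hderiv t ht).continuousAt.continuousWithinAt) ?_ ?_
    · rw [interior_Ioi]
      exact fun t ht => (hderiv t ht).differentiableAt.differentiableWithinAt
    · rw [interior_Ioi]
      intro t ht
      rw [(hderiv t ht).deriv]
      exact sub_nonneg.2 (h t ht)
  have htop : Tendsto Φ atTop (𝓝 (∑ i, c i * (p i * Real.log (p i)) - ∑ k, P k * Real.log (P k))) := by
    have h1 := (tendsto_finsetSum Finset.univ fun i _ =>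
      (tendsto_mul_log_add_atTop (hp i) (hq i)).const_mul (c i)).sub
      (tendsto_finsetSum Finset.univ fun k _ => tendsto_mul_log_add_atTop (hP k) (hQ k))
    refine h1.congr fun t => ?_
    simp_rw [mul_sub, Finset.sum_sub_distrib, ← mul_assoc, ← Finset.sum_mul, hsum]
    simp only [hΦ, mul_assoc]
    ring
  have hbot : Tendsto Φ (𝓝[>] 0)
      (𝓝 (∑ i, c i * (p i * Real.log (q i)) - ∑ k, P k * Real.log (Q k))) := by
    refine (tendsto_finsetSum Finset.univ fun i _ => ?_).sub
      (tendsto_finsetSum Finset.univ fun k _ =>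
        tendsto_mul_log_add_zero fun hk h0 => hk (hzero k h0))
    rcases eq_or_ne (c i) 0 with h0 | h0
    · simp [h0]
    · exact (tendsto_mul_log_add_zero fun hpi => hcpq i (mul_ne_zero h0 hpi)).const_mul (c i)
  have hle : ∀ s : ℝ, 0 < s →
      Φ s ≤ ∑ i, c i * (p i * Real.log (p i)) - ∑ k, P k * Real.log (P k) := fun s hs =>
    ge_of_tendsto htop (by
      filter_upwards [eventually_ge_atTop s] with t ht
      exact hmono hs (hs.trans_le ht) ht)
  have := le_of_tendsto hbot (by
    filter_upwards [self_mem_nhdsWithin] with s hs using hle s hs)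
  simp_rw [mul_sub, Finset.sum_sub_distrib]
  linarith

variable {d : Type*} [Fintype d] [DecidableEq d] {A B U V : Matrix d d ℂ} {p q : d → ℝ}

theorem trace_mul_re_nonneg (hA : A.PosSemidef) (hB : B.PosSemidef) : 0 ≤ (A * B).trace.re := by
  obtain ⟨U, p, hU, hp⟩ := exists_isSpectral_nonneg hA
  obtain ⟨V, q, hV, hq⟩ := exists_isSpectral_nonneg hB
  rw [hU.trace_mul_eq hV, Complex.ofReal_re]
  exact Finset.sum_nonneg fun i _ => Finset.sum_nonneg fun j _ =>
    mul_nonneg (overlap_nonneg _ _ _ _) (mul_nonneg (hp i) (hq j))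

/-- The operator Jensen inequality for the square and a positive operator-valued measure. -/
theorem posSemidef_sum_sq_sub {κ : Type*} [Fintype κ] {Λ : κ → Matrix d d ℂ}
    (hΛ : ∀ k, (Λ k).PosSemidef) (hsum : ∑ k, Λ k = 1) (a : κ → ℝ) :
    (∑ k, ((a k ^ 2 : ℝ) : ℂ) • Λ k -
      (∑ k, (a k : ℂ) • Λ k) * ∑ k, (a k : ℂ) • Λ k).PosSemidef := by
  set X := ∑ k, (a k : ℂ) • Λ k with hX
  have hXH : Xᴴ = X := by
    rw [hX, conjTranspose_sum]
    refine Finset.sum_congr rfl fun k _ => ?_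
    rw [conjTranspose_smul, (hΛ k).isHermitian.eq, RCLike.star_def, Complex.conj_ofReal]
  have h : ∑ k, ((a k ^ 2 : ℝ) : ℂ) • Λ k - X * X =
      ∑ k, ((a k : ℂ) • 1 - X)ᴴ * Λ k * ((a k : ℂ) • 1 - X) := by
    have e : ∀ k, ((a k : ℂ) • 1 - X)ᴴ * Λ k * ((a k : ℂ) • 1 - X) =
        ((a k ^ 2 : ℝ) : ℂ) • Λ k - ((a k : ℂ) • Λ k) * X - X * ((a k : ℂ) • Λ k) +
          X * Λ k * X := by
      intro k
      have : ((a k : ℂ) • (1 : Matrix d d ℂ) - X)ᴴ = (a k : ℂ) • 1 - X := by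
        rw [conjTranspose_sub, hXH, conjTranspose_smul, conjTranspose_one, RCLike.star_def,
          Complex.conj_ofReal]
      rw [this]
      simp only [Matrix.sub_mul, Matrix.mul_sub, Matrix.smul_mul, Matrix.mul_smul, Matrix.one_mul,
        Matrix.mul_one, smul_sub, smul_smul, pow_two, Complex.ofReal_mul]
      abel
    simp_rw [e]
    rw [Finset.sum_add_distrib, Finset.sum_sub_distrib, Finset.sum_sub_distrib, ← Finset.sum_mul,
      ← Finset.mul_sum, ← Finset.sum_mul, ← Finset.mul_sum, hsum, ← hX, Matrix.mul_one]
    abel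
  rw [h]
  exact posSemidef_sum _ fun k _ => (hΛ k).conjTranspose_mul_mul_same _

/-- Completing the square in `x`. -/
theorem two_mul_re_sub_le {x u : ℂ} {p q t : ℝ} (hp : 0 ≤ p) (hq : 0 ≤ q) (ht : 0 < t) :
    2 * ((x * (starRingEnd ℂ) u).re * p) - Complex.normSq x * (q + t * p) ≤
      Complex.normSq u * (p ^ 2 / (q + t * p)) := by
  rcases hp.eq_or_lt with h0 | hp
  · subst h0
    have := mul_nonneg (Complex.normSq_nonneg x) hq
    simp only [mul_zero, add_zero, ne_eq, OfNat.ofNat_ne_zero, not_false_eq_true, zero_pow,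
      zero_div]
    linarith
  have hpos : 0 < q + t * p := by positivity
  set e := q + t * p
  have h := Complex.normSq_nonneg (e * x - p * u)
  rw [← mul_div_assoc, le_div_iff₀ hpos]
  simp only [Complex.normSq_apply, Complex.mul_re, Complex.mul_im, Complex.sub_re, Complex.sub_im,
    Complex.ofReal_re, Complex.ofReal_im, Complex.conj_re, Complex.conj_im] at h ⊢
  nlinarith

/-- Each side is the maximum of a quadratic form: over scalars `a_k` for the measured quantity, over
matrices for the other. The measurement only offers the trial matrix `X = ∑ a_k Λ_k`, and operator
Jensen, `X² ≤ ∑ a_k² Λ_k`, shows that it does at least as well. -/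
theorem IsSpectral.sum_resolvent_le (hU : IsSpectral A U p) (hp : ∀ i, 0 ≤ p i)
    (hV : IsSpectral B V q) (hq : ∀ i, 0 ≤ q i) {κ : Type*} [Fintype κ] {Λ : κ → Matrix d d ℂ}
    (hΛ : ∀ k, (Λ k).PosSemidef) (hsum : ∑ k, Λ k = 1) {t : ℝ} (ht : 0 < t) :
    ∑ k, (Λ k * A).trace.re ^ 2 / ((Λ k * B).trace.re + t * (Λ k * A).trace.re) ≤
      ∑ i, ∑ j, overlap U V i j * (p i ^ 2 / (q j + t * p i)) := by
  have hA := hU.posSemidef hp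
  have hB := hV.posSemidef hq
  set P : κ → ℝ := fun k => (Λ k * A).trace.re with hP
  set Q : κ → ℝ := fun k => (Λ k * B).trace.re with hQ
  have hP0 : ∀ k, 0 ≤ P k := fun k => trace_mul_re_nonneg (hΛ k) hA
  have hQ0 : ∀ k, 0 ≤ Q k := fun k => trace_mul_re_nonneg (hΛ k) hB
  -- The maximiser of `2 a P - a² (Q + t P)`; it is `0` if the denominator vanishes.
  set a : κ → ℝ := fun k => P k / (Q k + t * P k) with ha
  set X := ∑ k, (a k : ℂ) • Λ k with hX
  have hJ := posSemidef_sum_sq_sub hΛ hsum a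
  rw [← hX] at hJ
  have hXH : Xᴴ = X := by
    rw [hX, conjTranspose_sum]
    refine Finset.sum_congr rfl fun k _ => ?_
    rw [conjTranspose_smul, (hΛ k).isHermitian.eq, RCLike.star_def, Complex.conj_ofReal]
  -- With rows in the eigenbasis of `A` and columns in that of `B`, the quadratic form decouples
  -- into single entries.
  set Y := Uᴴ * X * V with hY
  have tr_sum : ∀ (b : κ → ℝ) (C : Matrix d d ℂ),
      ((∑ k, (b k : ℂ) • Λ k) * C).trace.re = ∑ k, b k * (Λ k * C).trace.re := by
    intro b C
    rw [Matrix.sum_mul, trace_sum, Complex.re_sum]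
    refine Finset.sum_congr rfl fun k _ => ?_
    rw [Matrix.smul_mul, trace_smul, smul_eq_mul, Complex.re_ofReal_mul]
  have hXA : (X * X * A).trace.re ≤ ∑ k, a k ^ 2 * P k := by
    have := trace_mul_re_nonneg hJ hA
    rw [Matrix.sub_mul, trace_sub, Complex.sub_re, tr_sum] at this
    linarith
  have hXB : (X * X * B).trace.re ≤ ∑ k, a k ^ 2 * Q k := by
    have := trace_mul_re_nonneg hJ hB
    rw [Matrix.sub_mul, trace_sub, Complex.sub_re, tr_sum] at this
    linarith
  have hYA : (X * X * A).trace.re = ∑ i, ∑ j, Complex.normSq (Y i j) * p i := by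
    have h1 := trace_diagonal_conj p (fun _ => 1) Y
    have h2 : (diagonal (fun i => (p i : ℂ)) * Y * diagonal (fun i => (((1 : ℝ)) : ℂ)) * Yᴴ).trace =
        (X * X * A).trace := by
      have : diagonal (fun _ : d => ((1 : ℝ) : ℂ)) = 1 := by simp
      rw [this, Matrix.mul_one, hY, conjTranspose_mul, conjTranspose_mul, conjTranspose_conjTranspose,
        hXH]
      calc _ = (diagonal (fun i => (p i : ℂ)) * Uᴴ * X * (V * Vᴴ) * (X * U)).trace := by
            simp only [Matrix.mul_assoc]
        _ = (X * X * (U * diagonal (fun i => (p i : ℂ)) * Uᴴ)).trace := by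
            rw [hV.mul_star, Matrix.mul_one, trace_mul_comm, Matrix.mul_assoc X X, trace_mul_comm X]
            simp only [Matrix.mul_assoc]
        _ = _ := by rw [← hU.eq]
    rw [← h2, h1, Complex.ofReal_re]
    simp
  have hYB : (X * X * B).trace.re = ∑ i, ∑ j, Complex.normSq (Y i j) * q j := by
    have h1 := trace_diagonal_conj (fun _ => 1) q Y
    have h2 : (diagonal (fun i => (((1 : ℝ)) : ℂ)) * Y * diagonal (fun i => (q i : ℂ)) * Yᴴ).trace =
        (X * X * B).trace := by
      have : diagonal (fun _ : d => ((1 : ℝ) : ℂ)) = 1 := by simp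
      rw [this, Matrix.one_mul, hY, conjTranspose_mul, conjTranspose_mul, conjTranspose_conjTranspose,
        hXH]
      calc _ = (Uᴴ * (X * (V * diagonal (fun i => (q i : ℂ)) * Vᴴ) * X * U)).trace := by
            simp only [Matrix.mul_assoc]
        _ = (X * B * X * (U * Uᴴ)).trace := by
            rw [← hV.eq, trace_mul_comm]
            simp only [Matrix.mul_assoc]
        _ = _ := by
            rw [hU.mul_star, Matrix.mul_one, trace_mul_comm, Matrix.mul_assoc]
    rw [← h2, h1, Complex.ofReal_re]
    simp
  have hXP : ∑ k, a k * P k = ∑ i, ∑ j, (Y i j * (starRingEnd ℂ) ((Uᴴ * V) i j)).re * p i := by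
    rw [← tr_sum, ← hX]
    have h2 : (X * A).trace = (diagonal (fun i => (p i : ℂ)) * (Y * (Uᴴ * V)ᴴ)).trace := by
      rw [hY, conjTranspose_mul, conjTranspose_conjTranspose]
      calc _ = (X * (U * diagonal (fun i => (p i : ℂ)) * Uᴴ)).trace := by rw [← hU.eq]
        _ = (diagonal (fun i => (p i : ℂ)) * (Uᴴ * X * U)).trace := by
            rw [← Matrix.mul_assoc, trace_mul_comm, ← Matrix.mul_assoc, ← Matrix.mul_assoc,
              trace_mul_comm]
        _ = (diagonal (fun i => (p i : ℂ)) * (Uᴴ * X * (V * Vᴴ) * U)).trace := by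
            rw [hV.mul_star, Matrix.mul_one]
        _ = _ := by simp only [Matrix.mul_assoc]
    rw [h2, trace, Complex.re_sum]
    refine Finset.sum_congr rfl fun i _ => ?_
    rw [diag_apply, diagonal_mul, Complex.re_ofReal_mul, Matrix.mul_apply, Complex.re_sum,
      Finset.mul_sum]
    refine Finset.sum_congr rfl fun j _ => ?_
    rw [conjTranspose_apply, mul_comm]
    rfl
  have hterm : ∀ k, P k ^ 2 / (Q k + t * P k) =
      2 * (a k * P k) - (a k ^ 2 * Q k + t * (a k ^ 2 * P k)) := by
    intro k
    by_cases h0 : Q k + t * P k = 0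
    · have : P k = 0 := by
        have := hQ0 k; have := mul_nonneg ht.le (hP0 k)
        have : t * P k = 0 := by linarith
        exact (mul_eq_zero.1 this).resolve_left ht.ne'
      simp [ha, this]
    · simp only [ha]
      field_simp
      ring
  change ∑ k, P k ^ 2 / (Q k + t * P k) ≤ _
  calc _ = 2 * ∑ k, a k * P k - (∑ k, a k ^ 2 * Q k + t * ∑ k, a k ^ 2 * P k) := by
        simp_rw [hterm, Finset.sum_sub_distrib, Finset.sum_add_distrib, ← Finset.mul_sum]
    _ ≤ 2 * ∑ k, a k * P k - ((X * X * B).trace.re + t * (X * X * A).trace.re) := by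
        have := mul_le_mul_of_nonneg_left hXA ht.le
        linarith
    _ = ∑ i, ∑ j, (2 * ((Y i j * (starRingEnd ℂ) ((Uᴴ * V) i j)).re * p i) -
          Complex.normSq (Y i j) * (q j + t * p i)) := by
        rw [hXP, hYA, hYB]
        simp_rw [Finset.mul_sum, ← Finset.sum_add_distrib, ← Finset.sum_sub_distrib]
        refine Finset.sum_congr rfl fun i _ => Finset.sum_congr rfl fun j _ => ?_
        ring
    _ ≤ _ := Finset.sum_le_sum fun i _ => Finset.sum_le_sum fun j _ =>
        two_mul_re_sub_le (hp i) (hq j) ht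

/-- Monotonicity of the relative entropy under measurements. -/
theorem IsSpectral.measured_relEntropy_le (hU : IsSpectral A U p) (hp : ∀ i, 0 ≤ p i)
    (hV : IsSpectral B V q) (hq : ∀ i, 0 ≤ q i)
    (hsupp : ∀ i j, overlap U V i j * p i ≠ 0 → q j ≠ 0)
    {κ : Type*} [Fintype κ] {Λ : κ → Matrix d d ℂ}
    (hΛ : ∀ k, (Λ k).PosSemidef) (hsum : ∑ k, Λ k = 1) :
    (∀ k, (Λ k * B).trace.re = 0 → (Λ k * A).trace.re = 0) ∧
      ∑ k, (Λ k * A).trace.re *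
          (Real.log (Λ k * A).trace.re - Real.log (Λ k * B).trace.re) ≤
        ∑ i, ∑ j, overlap U V i j * (p i * (Real.log (p i) - Real.log (q j))) := by
  have h := relEntropy_le_of_resolvent_le (ι := d × d) (κ := κ)
    (c := fun x => overlap U V x.1 x.2) (p := fun x => p x.1) (q := fun x => q x.2)
    (P := fun k => (Λ k * A).trace.re) (Q := fun k => (Λ k * B).trace.re)
    (fun x => overlap_nonneg _ _ _ _) (fun x => hp _) (fun x => hq _)
    (fun k => trace_mul_re_nonneg (hΛ k) (hU.posSemidef hp))
    (fun k => trace_mul_re_nonneg (hΛ k) (hV.posSemidef hq)) (fun x => hsupp x.1 x.2) ?_ ?_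
  · simpa only [Fintype.sum_prod_type] using h
  · rw [← Complex.re_sum, ← trace_sum, ← Matrix.sum_mul, hsum, Matrix.one_mul, hU.trace_eq,
      Complex.ofReal_re, Fintype.sum_prod_type]
    simp_rw [← Finset.sum_mul, hU.sum_overlap_right hV, one_mul]
  · intro t ht
    rw [Fintype.sum_prod_type]
    exact hU.sum_resolvent_le hp hV hq hΛ hsum ht

end Measurement

/-! ### Relative entropy as a classical divergence of overlap weights. -/

section RelativeEntropy

variable {d : Type*} [Fintype d] [DecidableEq d] {A B U V : Matrix d d ℂ} {p q : d → ℝ}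

/-- `Tr[A (log A - log B)]`, the relative entropy where it is finite. -/
noncomputable def relEntropyReal (A B : Matrix d d ℂ) : ℝ :=
  (A * (logOp A - logOp B)).trace.re

theorem relEntropyReal_eq_sub (A B : Matrix d d ℂ) :
    relEntropyReal A B = negEntropy A - (A * logOp B).trace.re := by
  rw [relEntropyReal, Matrix.mul_sub, trace_sub, Complex.sub_re, negEntropy]

theorem relEntropyReal_self (A : Matrix d d ℂ) : relEntropyReal A A = 0 := by
  simp [relEntropyReal]

theorem relEntropy_toReal (h : supp A ≤ supp B) :
    (relEntropy A B).toReal = relEntropyReal A B := by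
  rw [relEntropy, if_pos h, EReal.toReal_coe, relEntropyReal]

theorem relEntropyReal_le_of_relEntropy_le {δ : ℝ} (h : relEntropy A B ≤ (δ : EReal)) :
    relEntropyReal A B ≤ δ := by
  unfold relEntropy at h
  split_ifs at h with hs
  · exact EReal.coe_le_coe_iff.1 h
  · simp at h

theorem IsSpectral.relEntropyReal_eq (hU : IsSpectral A U p) (hV : IsSpectral B V q) :
    relEntropyReal A B =
      ∑ i, ∑ j, overlap U V i j * (p i * (Real.log (p i) - Real.log (q j))) := by
  rw [relEntropyReal_eq_sub, hU.negEntropy_eq, logOp, hU.trace_mul_eq (hV.isSpectral_cfc _),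
    Complex.ofReal_re]
  simp_rw [mul_sub, Finset.sum_sub_distrib, ← Finset.sum_mul, hU.sum_overlap_right hV, one_mul]

/-- If `q j = 0`, the eigenvector `v_j` is orthogonal to the range of `B`, hence to `A v_j`. So
`⟨v_j, A v_j⟩ = 0`, a sum of nonnegative terms. -/
theorem IsSpectral.ne_zero_of_supp_le (hU : IsSpectral A U p) (hp : ∀ i, 0 ≤ p i)
    (hV : IsSpectral B V q) (h : supp A ≤ supp B) (i j : d) (hij : overlap U V i j * p i ≠ 0) :
    q j ≠ 0 := by
  intro hq
  apply hij
  obtain ⟨z, hz⟩ := h (LinearMap.mem_range_self (toLin' A) (fun k => V k j))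
  rw [toLin'_apply, toLin'_apply] at hz
  have hVB : Vᴴ * B = diagonal (fun i => (q i : ℂ)) * Vᴴ := by
    rw [hV.eq, ← Matrix.mul_assoc, ← Matrix.mul_assoc, hV.star_mul, Matrix.one_mul]
  have h0 : (Vᴴ * A * V) j j = 0 := by
    have h1 : (Vᴴ * A * V) j j = (Vᴴ *ᵥ (A *ᵥ fun k => V k j)) j := by
      rw [mulVec_mulVec]; rfl
    rw [h1, ← hz, mulVec_mulVec, hVB, ← mulVec_mulVec, mulVec_diagonal, hq]
    simp
  have h1 : diagEntry V A j = 0 := by rw [diagEntry, h0, Complex.zero_re]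
  rw [hU.diagEntry_eq_sum] at h1
  have := (Finset.sum_eq_zero_iff_of_nonneg fun i _ =>
    mul_nonneg (overlap_nonneg V U j i) (hp i)).1 h1 i (Finset.mem_univ i)
  rwa [overlap_symm]

end RelativeEntropy

/-! ### Tensor products and additivity. -/

section Tensor

variable {d : Type*} {n : ℕ}

theorem sum_prod_eq_prod_sum {ι R : Type*} [Fintype ι] [CommSemiring R] (w : Fin n → ι → R) :
    ∑ z : Fin n → ι, ∏ i, w i (z i) = ∏ i, ∑ s, w i s := by
  rw [Finset.prod_univ_sum, Fintype.piFinset_univ]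

/-- The expectation of a sum under a product distribution sees only the marginals. -/
theorem sum_prod_mul_sum {ι : Type*} [Fintype ι] (w g : Fin n → ι → ℝ)
    (hw : ∀ i, ∑ s, w i s = 1) :
    ∑ z : Fin n → ι, (∏ i, w i (z i)) * ∑ l, g l (z l) = ∑ l, ∑ s, w l s * g l s := by
  simp_rw [Finset.mul_sum]
  rw [Finset.sum_comm]
  refine Finset.sum_congr rfl fun l _ => ?_
  have h : ∀ z : Fin n → ι, (∏ i, w i (z i)) * g l (z l) =
      ∏ i, (w i (z i) * if i = l then g l (z i) else 1) := by
    intro z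
    rw [Finset.prod_mul_distrib, Finset.prod_ite_eq' Finset.univ l fun i => g l (z i)]
    simp
  simp_rw [h]
  rw [sum_prod_eq_prod_sum fun i s => w i s * if i = l then g l s else 1,
    Finset.prod_eq_single l]
  · simp
  · intro i _ hi
    simp [hi, hw]
  · simp

variable [Fintype d]

theorem tensor_mul_tensor (A B : Fin n → Matrix d d ℂ) :
    tensor A * tensor B = tensor fun i => A i * B i := by
  ext u v
  simp only [Matrix.mul_apply, tensor, ← Finset.prod_mul_distrib]
  exact sum_prod_eq_prod_sum fun i s => A i (u i) s * B i s (v i)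

omit [Fintype d] in
theorem conjTranspose_tensor (A : Fin n → Matrix d d ℂ) :
    (tensor A)ᴴ = tensor fun i => (A i)ᴴ := by
  ext u v
  simp [tensor, conjTranspose_apply]

omit [Fintype d] in
theorem tensor_diagonal [DecidableEq d] (a : Fin n → d → ℂ) :
    tensor (fun i => diagonal (a i)) = diagonal fun u => ∏ i, a i (u i) := by
  ext u v
  by_cases h : u = v
  · subst h; simp [tensor]
  · rw [diagonal_apply_ne _ h]
    obtain ⟨i, hi⟩ := Function.ne_iff.1 h
    exact Finset.prod_eq_zero (Finset.mem_univ i) (diagonal_apply_ne _ hi)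

omit [Fintype d] in
theorem tensor_one [DecidableEq d] : tensor (fun _ : Fin n => (1 : Matrix d d ℂ)) = 1 := by
  rw [← diagonal_one]
  simp_rw [tensor_diagonal]
  simp

variable [DecidableEq d]

theorem IsSpectral.tensor {A U : Fin n → Matrix d d ℂ} {p : Fin n → d → ℝ}
    (h : ∀ i, IsSpectral (A i) (U i) (p i)) :
    IsSpectral (tensor A) (tensor U) (fun u => ∏ i, p i (u i)) := by
  refine ⟨?_, ?_, ?_⟩
  · rw [conjTranspose_tensor, tensor_mul_tensor]
    simp_rw [(h _).star_mul]
    exact tensor_one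
  · rw [conjTranspose_tensor, tensor_mul_tensor]
    simp_rw [(h _).mul_star]
    exact tensor_one
  · have : diagonal (fun u => ((∏ i, p i (u i) : ℝ) : ℂ)) =
        CovertSecrecy.tensor fun i => diagonal fun j => (p i j : ℂ) := by
      rw [tensor_diagonal]
      push_cast
      rfl
    rw [this, conjTranspose_tensor, tensor_mul_tensor, tensor_mul_tensor]
    simp_rw [← (h _).eq]

omit [DecidableEq d] in
theorem overlap_tensor (U V : Fin n → Matrix d d ℂ) (u v : Fin n → d) :
    overlap (tensor U) (tensor V) u v = ∏ i, overlap (U i) (V i) (u i) (v i) := by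
  rw [overlap, conjTranspose_tensor, tensor_mul_tensor]
  simp [tensor, overlap]

omit [DecidableEq d] in
theorem isDensity_tensor {A : Fin n → Matrix d d ℂ} (hA : ∀ i, IsDensity (A i)) :
    IsDensity (tensor A) := by
  classical
  choose U p hU hp using fun i => exists_isSpectral_nonneg (hA i).1
  refine ⟨(IsSpectral.tensor hU).posSemidef fun u => Finset.prod_nonneg fun i _ => hp i _, ?_⟩
  have : (tensor A).trace = ∏ i, (A i).trace := sum_prod_eq_prod_sum fun i s => A i s s
  rw [this]
  simp [(hA _).2]

/-- Additivity of the relative entropy. -/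
theorem relEntropyReal_tensor {A B : Fin n → Matrix d d ℂ} (hA : ∀ i, IsDensity (A i))
    (hB : ∀ i, IsDensity (B i)) (hAB : ∀ i, supp (A i) ≤ supp (B i)) :
    relEntropyReal (tensor A) (tensor B) = ∑ i, relEntropyReal (A i) (B i) := by
  choose U p hU hp using fun i => exists_isSpectral_nonneg (hA i).1
  choose V q hV hq using fun i => exists_isSpectral_nonneg (hB i).1
  rw [(IsSpectral.tensor hU).relEntropyReal_eq (IsSpectral.tensor hV)]
  have hw : ∀ i, ∑ s : d × d, overlap (U i) (V i) s.1 s.2 * p i s.1 = 1 := by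
    intro i
    rw [Fintype.sum_prod_type]
    simp_rw [← Finset.sum_mul, (hU i).sum_overlap_right (hV i), one_mul]
    have := (hU i).trace_eq
    rw [(hA i).2] at this
    exact_mod_cast this.symm
  have h := sum_prod_mul_sum (fun i (s : d × d) => overlap (U i) (V i) s.1 s.2 * p i s.1)
    (fun i s => Real.log (p i s.1) - Real.log (q i s.2)) hw
  rw [← Fintype.sum_prod_type', ← (Equiv.arrowProdEquivProdArrow (Fin n) (fun _ => d)
    (fun _ => d)).sum_comp]
  refine Eq.trans (Finset.sum_congr rfl fun z _ => ?_) (h.trans (Finset.sum_congr rfl fun i _ => ?_))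
  · simp only [Equiv.arrowProdEquivProdArrow_apply]
    rw [overlap_tensor, ← mul_assoc, ← Finset.prod_mul_distrib]
    -- The logarithm of a product splits only for nonzero factors; tuples of weight zero are
    -- discarded first.
    by_cases h0 : ∏ i, overlap (U i) (V i) (z i).1 (z i).2 * p i (z i).1 = 0
    · rw [h0, zero_mul, zero_mul]
    have h1 := fun i => Finset.prod_ne_zero_iff.1 h0 i (Finset.mem_univ i)
    rw [Real.log_prod fun i _ => right_ne_zero_of_mul (h1 i),
      Real.log_prod fun i _ => (hU i).ne_zero_of_supp_le (hp i) (hV i) (hAB i) _ _ (h1 i), Finset.sum_sub_distrib]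
  · rw [(hU i).relEntropyReal_eq (hV i), Fintype.sum_prod_type]
    simp_rw [mul_assoc]

theorem measured_relEntropy_tensor_le {A B : Fin n → Matrix d d ℂ} (hA : ∀ i, IsDensity (A i))
    (hB : ∀ i, IsDensity (B i)) (hAB : ∀ i, supp (A i) ≤ supp (B i))
    {κ : Type*} [Fintype κ] {Λ : κ → Matrix (Fin n → d) (Fin n → d) ℂ}
    (hΛ : ∀ k, (Λ k).PosSemidef) (hsum : ∑ k, Λ k = 1) :
    (∀ k, (Λ k * tensor B).trace.re = 0 → (Λ k * tensor A).trace.re = 0) ∧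
      ∑ k, (Λ k * tensor A).trace.re *
          (Real.log (Λ k * tensor A).trace.re - Real.log (Λ k * tensor B).trace.re) ≤
        ∑ i, relEntropyReal (A i) (B i) := by
  choose U p hU hp using fun i => exists_isSpectral_nonneg (hA i).1
  choose V q hV hq using fun i => exists_isSpectral_nonneg (hB i).1
  rw [← relEntropyReal_tensor hA hB hAB,
    (IsSpectral.tensor hU).relEntropyReal_eq (IsSpectral.tensor hV)]
  refine (IsSpectral.tensor hU).measured_relEntropy_le
    (fun u => Finset.prod_nonneg fun i _ => hp i _) (IsSpectral.tensor hV)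
    (fun u => Finset.prod_nonneg fun i _ => hq i _) (fun u v huv => ?_) hΛ hsum
  rw [overlap_tensor, ← Finset.prod_mul_distrib] at huv
  exact Finset.prod_ne_zero_iff.2 fun i hi => (hU i).ne_zero_of_supp_le (hp i) (hV i) (hAB i) _ _
    (Finset.prod_ne_zero_iff.1 huv i hi)

end Tensor

/-! ### Marginals of the channel and weights of codewords. -/

section Channel

variable {b w : Type*} [Fintype b] [Fintype w]

theorem isDensity_trRight {ρ : Matrix (b × w) (b × w) ℂ} (h : IsDensity ρ) :
    IsDensity (trRight ρ) := by
  have e : trRight ρ = ∑ k, ρ.submatrix (fun i => (i, k)) (fun i => (i, k)) := by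
    ext i j
    simp [trRight, Matrix.sum_apply]
  refine ⟨e ▸ posSemidef_sum _ fun k _ => h.1.submatrix _, ?_⟩
  rw [← h.2, trace, trace, Fintype.sum_prod_type]
  rfl

theorem isDensity_trLeft {ρ : Matrix (b × w) (b × w) ℂ} (h : IsDensity ρ) :
    IsDensity (trLeft ρ) := by
  have e : trLeft ρ = ∑ k, ρ.submatrix (fun i => (k, i)) (fun i => (k, i)) := by
    ext i j
    simp [trLeft, Matrix.sum_apply]
  refine ⟨e ▸ posSemidef_sum _ fun k _ => h.1.submatrix _, ?_⟩
  rw [← h.2, trace, trace, Fintype.sum_prod_type_right]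
  rfl

namespace CQChannel

variable (P : CQChannel b w) {n : ℕ}

theorem isDensity_bob (x : Fin 2) : IsDensity (P.bob x) := isDensity_trRight (P.isDensity_out x)

theorem isDensity_willie (x : Fin 2) : IsDensity (P.willie x) :=
  isDensity_trLeft (P.isDensity_out x)

theorem trRight_outSeq (x : Fin n → Fin 2) :
    trRight (P.outSeq x) = tensor fun i => P.bob (x i) := by
  ext u v
  exact sum_prod_eq_prod_sum fun i s => P.out (x i) (u i, s) (v i, s)

theorem trLeft_outSeq (x : Fin n → Fin 2) :
    trLeft (P.outSeq x) = tensor fun i => P.willie (x i) := by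
  ext u v
  exact sum_prod_eq_prod_sum fun i s => P.out (x i) (s, u i) (s, v i)

end CQChannel

/-- The number of non-innocent symbols of a codeword. -/
def weight {n : ℕ} (x : Fin n → Fin 2) : ℝ := ∑ i, if x i = 1 then 1 else 0

theorem weight_nonneg {n : ℕ} (x : Fin n → Fin 2) : 0 ≤ weight x :=
  Finset.sum_nonneg fun i _ => by split_ifs <;> norm_num

theorem sum_relEntropyReal_eq_weight_mul {d : Type*} [Fintype d] [DecidableEq d]
    (A : Fin 2 → Matrix d d ℂ) {n : ℕ} (x : Fin n → Fin 2) :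
    ∑ i, relEntropyReal (A (x i)) (A 0) = weight x * relEntropyReal (A 1) (A 0) := by
  rw [weight, Finset.sum_mul]
  refine Finset.sum_congr rfl fun i _ => ?_
  rcases Fin.exists_fin_two.1 ⟨x i, rfl⟩ with h | h
  · simp [h, relEntropyReal_self]
  · simp [h]

end Channel

/-! ### Dimension-free Holevo bound and the cost of secrecy. -/

section Secrecy

variable {d : Type*} [Fintype d] [DecidableEq d]

theorem exists_jordan_decomposition {X : Matrix d d ℂ} (hX : X.IsHermitian) :
    ∃ A B : Matrix d d ℂ, A.PosSemidef ∧ B.PosSemidef ∧ X = A - B ∧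
      traceNorm X = A.trace.re + B.trace.re := by
  obtain ⟨U, hU⟩ := exists_isSpectral hX
  set x := hX.eigenvalues
  have hA := hU.map fun t => max t 0
  have hB := hU.map fun t => max (-t) 0
  refine ⟨_, _, hA.posSemidef fun i => le_max_right _ _, hB.posSemidef fun i => le_max_right _ _,
    ?_, ?_⟩
  · rw [← Matrix.sub_mul, ← Matrix.mul_sub, diagonal_sub]
    conv_lhs => rw [hU.eq]
    congr 3
    funext i
    rw [← Complex.ofReal_sub, max_zero_sub_max_neg_zero_eq_self]
  · have hsq : IsSpectral (Xᴴ * X) U (fun i => x i ^ 2) := by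
      have h := hU.map fun t => t ^ 2
      convert h using 1
      rw [hX.eq]
      conv_lhs => rw [hU.eq]
      calc _ = U * diagonal (fun i => (x i : ℂ)) * (Uᴴ * U) * diagonal (fun i => (x i : ℂ)) * Uᴴ := by
            simp only [Matrix.mul_assoc]
        _ = _ := by
          rw [hU.star_mul, Matrix.mul_one, Matrix.mul_assoc U, diagonal_mul_diagonal]
          simp [pow_two]
    rw [traceNorm, (hsq.isSpectral_cfc Real.sqrt).trace_eq, hA.trace_eq, hB.trace_eq,
      Complex.ofReal_re, Complex.ofReal_re, Complex.ofReal_re, ← Finset.sum_add_distrib]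
    refine Finset.sum_congr rfl fun i _ => ?_
    rw [Real.sqrt_sq_eq_abs]
    rcases le_total 0 (x i) with h | h
    · rw [abs_of_nonneg h, max_eq_left h, max_eq_right (neg_nonpos.2 h), add_zero]
    · rw [abs_of_nonpos h, max_eq_right h, max_eq_left (neg_nonneg.2 h), zero_add]

/-- The mixing entropy of weights `1` and `t`. -/
noncomputable def mixEntropy (t : ℝ) : ℝ := (1 + t) * Real.log (1 + t) - t * Real.log t

theorem tendsto_mixEntropy {t : ℕ → ℝ} (ht : Tendsto t atTop (𝓝 0)) :
    Tendsto (fun n => mixEntropy (t n)) atTop (𝓝 0) := by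
  have h : Continuous mixEntropy :=
    (Real.continuous_mul_log.comp (continuous_const.add continuous_id)).sub Real.continuous_mul_log
  have h0 : mixEntropy 0 = 0 := by simp [mixEntropy]
  exact h0 ▸ (h.tendsto 0).comp ht

/-- Concavity: `-mixEntropy t` is the divergence of the pair `(1, t)` from `(1 + t, 1 + t)`, so two
log-sum inequalities suffice. -/
theorem avg_mixEntropy_le {ι : Type*} [Fintype ι] [Nonempty ι] {t : ι → ℝ} (ht : ∀ m, 0 ≤ t m) :
    1 / (Fintype.card ι : ℝ) * ∑ m, mixEntropy (t m) ≤
      mixEntropy (1 / (Fintype.card ι : ℝ) * ∑ m, t m) := by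
  set c : ℝ := (Fintype.card ι : ℝ) with hcdef
  have hc : 0 < c := by positivity
  set T := ∑ m, t m
  have hT : 0 ≤ T := Finset.sum_nonneg fun m _ => ht m
  have h1 := log_sum_inequality Finset.univ (fun _ : ι => (1 : ℝ)) (fun m => 1 + t m)
    (fun _ _ => zero_le_one) (fun m _ => by linarith [ht m]) (fun m _ h => by linarith [ht m])
  have h2 := log_sum_inequality Finset.univ t (fun m => 1 + t m)
    (fun m _ => ht m) (fun m _ => by linarith [ht m]) (fun m _ h => by linarith [ht m])
  have e1 : ∑ _m : ι, (1 : ℝ) = c := by simp [hcdef]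
  have e2 : ∑ m, (1 + t m) = c + T := by rw [Finset.sum_add_distrib, e1]
  rw [e2] at h1 h2
  rw [e1] at h1
  have h3 : ∑ m, mixEntropy (t m) = -(∑ m, 1 * (Real.log 1 - Real.log (1 + t m)) +
      ∑ m, t m * (Real.log (t m) - Real.log (1 + t m))) := by
    rw [← Finset.sum_add_distrib, ← Finset.sum_neg_distrib]
    refine Finset.sum_congr rfl fun m _ => ?_
    rw [mixEntropy, Real.log_one]
    ring
  have h4 : c * mixEntropy (1 / c * T) = -(c * (Real.log c - Real.log (c + T)) +
      T * (Real.log T - Real.log (c + T))) := by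
    have e : 1 + 1 / c * T = (c + T) / c := by field_simp
    rw [mixEntropy, e, Real.log_div (by positivity) hc.ne']
    rcases hT.eq_or_lt with h0 | hT
    · rw [← h0]; simp
    · rw [one_div_mul_eq_div, Real.log_div hT.ne' hc.ne']
      field_simp
      ring
  rw [one_div_mul_eq_div, div_le_iff₀ hc, mul_comm (mixEntropy _), h4, h3]
  linarith

omit [Fintype d] [DecidableEq d] in
theorem posSemidef_avg {ι : Type*} [Fintype ι] {A : ι → Matrix d d ℂ}
    (hA : ∀ m, (A m).PosSemidef) : ((1 / (Fintype.card ι : ℂ)) • ∑ m, A m).PosSemidef := by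
  refine (posSemidef_sum _ fun m _ => hA m).smul ?_
  have : (0 : ℝ) ≤ 1 / (Fintype.card ι : ℝ) := by positivity
  have := Complex.zero_le_real.2 this
  push_cast at this
  exact this

omit [DecidableEq d] in
theorem trace_avg {ι : Type*} [Fintype ι] (A : ι → Matrix d d ℂ) :
    ((1 / (Fintype.card ι : ℂ)) • ∑ m, A m).trace.re =
      1 / (Fintype.card ι : ℝ) * ∑ m, (A m).trace.re := by
  rw [trace_smul, trace_sum, smul_eq_mul, ← Complex.re_sum, ← Complex.re_ofReal_mul]
  push_cast
  rfl

omit [DecidableEq d] in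
theorem isDensity_avg {ι : Type*} [Fintype ι] [Nonempty ι] {A : ι → Matrix d d ℂ}
    (hA : ∀ m, IsDensity (A m)) : IsDensity ((1 / (Fintype.card ι : ℂ)) • ∑ m, A m) := by
  refine ⟨posSemidef_avg fun m => (hA m).1, ?_⟩
  simp [trace_smul, trace_sum, (hA _).2]

theorem negEntropy_avg_le {ι : Type*} [Fintype ι] [Nonempty ι] {A : ι → Matrix d d ℂ}
    (hA : ∀ m, (A m).PosSemidef) :
    negEntropy ((1 / (Fintype.card ι : ℂ)) • ∑ m, A m) ≤
      1 / (Fintype.card ι : ℝ) * ∑ m, negEntropy (A m) := by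
  have h := negEntropy_sum_smul_le (w := fun _ : ι => 1 / (Fintype.card ι : ℝ))
    (fun _ => by positivity) (by simp) hA
  rw [← Finset.smul_sum, ← Finset.mul_sum] at h
  push_cast at h
  exact h

/-- The Holevo information of a uniform ensemble of states which are close, on average, to a fixed
state: the dimension of the space does not enter the bound. -/
theorem holevo_le {ι : Type*} [Fintype ι] [Nonempty ι] {ρ : ι → Matrix d d ℂ}
    {τ : Matrix d d ℂ} (hρ : ∀ m, IsDensity (ρ m)) (hτ : IsDensity τ) {t : ℝ}
    (ht : t = 1 / (Fintype.card ι : ℝ) * (∑ m, traceNorm (ρ m - τ)) / 2) :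
    1 / (Fintype.card ι : ℝ) * ∑ m, negEntropy (ρ m) ≤
      negEntropy ((1 / (Fintype.card ι : ℂ)) • ∑ m, ρ m) + t * Real.log (Fintype.card ι) +
        2 * mixEntropy t := by
  choose A B hA hB hX hn using fun m =>
    exists_jordan_decomposition ((hρ m).1.isHermitian.sub hτ.1.isHermitian)
  have htr : ∀ m, (A m).trace.re = (B m).trace.re := fun m => by
    have := congrArg (fun X => (trace X).re) (hX m)
    simp only [trace_sub, (hρ m).2, hτ.2, Complex.sub_re, sub_self, Complex.zero_re] at this
    linarith
  -- Adding the small positive parts, of trace half the trace distance, trades `ρ m` for the fixed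
  -- `τ`.
  have hsum : ∀ m, ρ m + B m = τ + A m := fun m => by
    rw [sub_eq_sub_iff_add_eq_add.1 (hX m), add_comm]
  set c : ℝ := (Fintype.card ι : ℝ) with hcdef
  have hc : 0 < c := by positivity
  have hA0 : ∀ m, 0 ≤ (A m).trace.re := fun m => (Complex.le_def.1 (hA m).trace_nonneg).1
  have htA : 1 / c * ∑ m, (A m).trace.re = t := by
    have : ∀ m, traceNorm (ρ m - τ) = 2 * (A m).trace.re := fun m => by
      rw [hn m, ← htr m]; ring
    rw [ht]
    simp_rw [this, ← Finset.mul_sum]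
    ring
  have htB : 1 / c * ∑ m, (B m).trace.re = t := by rw [← htA]; simp_rw [htr]
  have avg_le : ∀ {f g : ι → ℝ}, (∀ m, f m ≤ g m) → 1 / c * ∑ m, f m ≤ 1 / c * ∑ m, g m :=
    fun h => mul_le_mul_of_nonneg_left (Finset.sum_le_sum fun m _ => h m) (by positivity)
  -- Every entropy is moved across the identity `ρ m + B m = τ + A m` or its average. The gap of the
  -- family `A` costs `t * log |ι|`, the `B` terms cancel by convexity, and `mixEntropy` is paid
  -- once for each of the two upper bounds on a sum.
  have h1 := avg_le fun m => negEntropy_add_ge (hρ m).1 (hB m)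
  have h2 := negEntropy_add_le (isDensity_avg hρ).1 (posSemidef_avg hB)
  have h3 := negEntropy_avg_le hB
  have h4 := avg_le fun m => negEntropy_add_le hτ.1 (hA m)
  have h5 := negEntropy_add_ge hτ.1 (posSemidef_avg hA)
  have h6 := avg_negEntropy_le hA
  have h7 := avg_mixEntropy_le hA0
  have e1 : (1 / (Fintype.card ι : ℂ)) • ∑ m, ρ m + (1 / (Fintype.card ι : ℂ)) • ∑ m, B m =
      τ + (1 / (Fintype.card ι : ℂ)) • ∑ m, A m := by
    rw [← smul_add, ← Finset.sum_add_distrib]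
    simp_rw [hsum]
    rw [Finset.sum_add_distrib, smul_add, Finset.sum_const, Finset.card_univ,
      ← Nat.cast_smul_eq_nsmul ℂ, smul_smul, one_div_mul_cancel (by simp), one_smul]
  simp_rw [hsum] at h1
  rw [e1, trace_avg B, (isDensity_avg hρ).2] at h2
  rw [← hcdef] at h2 h3 h6 h7
  rw [htB, Complex.one_re, Real.log_one] at h2
  rw [hτ.2] at h4
  have e2 : ∀ m, (Complex.re 1 + (A m).trace.re) * Real.log (Complex.re 1 + (A m).trace.re) -
      Complex.re 1 * Real.log (Complex.re 1) - (A m).trace.re * Real.log (A m).trace.re =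
      mixEntropy (A m).trace.re := fun m => by
    rw [Complex.one_re, Real.log_one, mixEntropy]; ring
  have e3 : 1 / c * ∑ _m : ι, negEntropy τ = negEntropy τ := by
    rw [Finset.sum_const, Finset.card_univ, nsmul_eq_mul, ← mul_assoc, one_div_mul_cancel hc.ne',
      one_mul]
  simp_rw [e2] at h4
  rw [Finset.sum_add_distrib, mul_add] at h1
  rw [Finset.sum_add_distrib, Finset.sum_add_distrib, mul_add, mul_add, e3] at h4
  rw [htA] at h6 h7
  have e4 : mixEntropy t = (1 + t) * Real.log (1 + t) - t * Real.log t := rfl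
  linarith

/-- A covert and secret ensemble needs a local randomness (public messages and keys) of the order of
the relative entropy of its members to the innocent state. -/
theorem avg_relEntropyReal_le {ι κ : Type*} [Fintype ι] [Nonempty ι] [Fintype κ] [Nonempty κ]
    {ω : ι → κ → Matrix d d ℂ} {ρ : ι → Matrix d d ℂ} {τ σ : Matrix d d ℂ} {t δ : ℝ}
    (hω : ∀ m k, IsDensity (ω m k)) (hτ : IsDensity τ)
    (hρ : ∀ m, ρ m = (1 / (Fintype.card κ : ℂ)) • ∑ k, ω m k)
    (ht : t = 1 / (Fintype.card ι : ℝ) * (∑ m, traceNorm (ρ m - τ)) / 2)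
    (hδ : relEntropyReal ((1 / (Fintype.card ι : ℂ)) • ∑ m, ρ m) σ ≤ δ) :
    1 / (Fintype.card ι : ℝ) * ∑ m, 1 / (Fintype.card κ : ℝ) * ∑ k, relEntropyReal (ω m k) σ ≤
      Real.log (Fintype.card κ) + t * Real.log (Fintype.card ι) + 2 * mixEntropy t + δ := by
  have hρd : ∀ m, IsDensity (ρ m) := fun m => hρ m ▸ isDensity_avg (hω m)
  have h1 := holevo_le hρd hτ ht
  -- Since `Tr[ρ log σ]` is linear in `ρ`, only entropy gaps separate the average divergence from
  -- that of the mixture: this one inside each message, the Holevo one between messages.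
  have h2 : ∀ m, 1 / (Fintype.card κ : ℝ) * ∑ k, negEntropy (ω m k) ≤
      negEntropy (ρ m) + Real.log (Fintype.card κ) := fun m => by
    have := avg_negEntropy_le fun k => (hω m k).1
    rw [← hρ m] at this
    simpa [(hω m _).2] using this
  have avg_tr : ∀ {α : Type _} [Fintype α] (A : α → Matrix d d ℂ) (L : Matrix d d ℂ),
      (((1 / (Fintype.card α : ℂ)) • ∑ m, A m) * L).trace.re =
        1 / (Fintype.card α : ℝ) * ∑ m, (A m * L).trace.re := by
    intro α _ A L
    rw [Matrix.smul_mul, Matrix.sum_mul, trace_avg]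
  have avg_tr' : ∀ m, (ρ m * logOp σ).trace.re =
      1 / (Fintype.card κ : ℝ) * ∑ m_1, (ω m m_1 * logOp σ).trace.re := by
    intro m
    rw [hρ m, Matrix.smul_mul, Matrix.sum_mul, trace_avg]
  rw [relEntropyReal_eq_sub, avg_tr] at hδ
  simp_rw [avg_tr'] at hδ
  have h3 := mul_le_mul_of_nonneg_left (Finset.sum_le_sum fun m (_ : m ∈ Finset.univ) => h2 m)
    (by positivity : 0 ≤ 1 / (Fintype.card ι : ℝ))
  rw [Finset.sum_add_distrib, mul_add, Finset.sum_const, Finset.card_univ, nsmul_eq_mul,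
    ← mul_assoc (1 / (Fintype.card ι : ℝ)) (Fintype.card ι : ℝ),
    one_div_mul_cancel (by positivity), one_mul] at h3
  simp_rw [relEntropyReal_eq_sub, Finset.sum_sub_distrib, mul_sub, Finset.sum_sub_distrib, mul_sub]
  linarith

end Secrecy

/-! ### A Fano inequality for families of binary tests. -/

section Fano

/-- Joint convexity of the binary divergence, through two log-sum inequalities, reduces the family
to `d(a‖1/m)`, which is at least `a log m - h(a)`. -/
theorem fano {J : Type*} [Fintype J] [Nonempty J] {p q D : J → ℝ} {m : ℝ} (hm : 1 ≤ m)
    (hp : ∀ j, 0 ≤ p j) (hp1 : ∀ j, p j ≤ 1) (hq : ∀ j, 0 ≤ q j) (hq1 : ∀ j, q j ≤ 1)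
    (h0 : ∀ j, q j = 0 → p j = 0) (h1 : ∀ j, 1 - q j = 0 → 1 - p j = 0)
    (hD : ∀ j, p j * (Real.log (p j) - Real.log (q j)) +
      (1 - p j) * (Real.log (1 - p j) - Real.log (1 - q j)) ≤ D j)
    (hsum : ∑ j, q j = Fintype.card J / m) {a : ℝ}
    (ha : a = 1 / (Fintype.card J : ℝ) * ∑ j, p j) :
    a * Real.log m - Real.binEntropy a ≤ 1 / (Fintype.card J : ℝ) * ∑ j, D j := by
  set c : ℝ := (Fintype.card J : ℝ) with hcdef
  have hc : 0 < c := by positivity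
  have hm0 : 0 < m := by linarith
  have hcp : ∑ j, p j = c * a := by rw [ha]; field_simp
  have ha0 : 0 ≤ a := by
    rw [ha]; exact mul_nonneg (by positivity) (Finset.sum_nonneg fun j _ => hp j)
  have e1 : ∑ _j : J, (1 : ℝ) = c := by simp [hcdef]
  have ha1 : a ≤ 1 := by
    have : ∑ j, p j ≤ ∑ _j : J, (1 : ℝ) := Finset.sum_le_sum fun j _ => hp1 j
    rw [hcp, e1] at this
    exact le_of_mul_le_mul_left (by linarith) hc
  have l1 := log_sum_inequality Finset.univ p q (fun j _ => hp j) (fun j _ => hq j)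
    (fun j _ => h0 j)
  have l2 := log_sum_inequality Finset.univ (fun j => 1 - p j) (fun j => 1 - q j)
    (fun j _ => sub_nonneg.2 (hp1 j)) (fun j _ => sub_nonneg.2 (hq1 j)) (fun j _ => h1 j)
  rw [Finset.sum_sub_distrib, Finset.sum_sub_distrib, e1, hsum, hcp] at l2
  rw [hsum, hcp] at l1
  have l3 := Finset.sum_le_sum fun j (_ : j ∈ Finset.univ) => hD j
  rw [Finset.sum_add_distrib] at l3
  have f1 : c * (a * Real.log a + a * Real.log m) =
      c * a * (Real.log (c * a) - Real.log (c / m)) := by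
    rcases ha0.eq_or_lt with h | h
    · rw [← h]; simp
    · rw [Real.log_mul hc.ne' h.ne', Real.log_div hc.ne' hm0.ne']; ring
  -- The nonnegative term `-log (1 - 1/m)` is dropped. For `m = 1` the logarithm is `log 0 = 0`, and
  -- `0 ≤ log c` since `J` is nonempty.
  have f2 : c * ((1 - a) * Real.log (1 - a)) ≤
      (c - c * a) * (Real.log (c - c * a) - Real.log (c - c / m)) := by
    rcases ha1.eq_or_lt with h | h
    · rw [h]; simp
    have h1a : 0 < 1 - a := by linarith
    have e : c - c * a = c * (1 - a) := by ring
    have hlog : Real.log (c - c / m) ≤ Real.log c := by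
      have hle : c / m ≤ c := div_le_self hc.le hm
      rcases hle.eq_or_lt with h | h
      · rw [h, sub_self, Real.log_zero]
        refine Real.log_nonneg ?_
        simp only [hcdef]
        exact_mod_cast Fintype.card_pos
      · refine Real.log_le_log (by linarith) ?_
        have : 0 ≤ c / m := by positivity
        linarith
    rw [e, Real.log_mul hc.ne' h1a.ne', mul_assoc]
    refine mul_le_mul_of_nonneg_left (mul_le_mul_of_nonneg_left ?_ h1a.le) hc.le
    linarith
  rw [one_div_mul_eq_div, le_div_iff₀ hc, Real.binEntropy_eq_negMulLog_add_negMulLog_one_sub,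
    Real.negMulLog, Real.negMulLog]
  nlinarith

end Fano

/-! ### The two one-shot bounds on the weight of a code. -/

namespace SecrecyCode

variable {n : ℕ} {b w : Type*} [Fintype b] [DecidableEq b] [Fintype w]

/-- The average number of non-innocent symbols of a codeword. -/
noncomputable def avgWeight (C : SecrecyCode n b) : ℝ :=
  1 / ((Fintype.card C.M : ℝ) * Fintype.card C.L * Fintype.card C.K) *
    ∑ m, ∑ l, ∑ k, weight (C.enc m l k)

variable (C : SecrecyCode n b) (P : CQChannel b w)

theorem posSemidef_one_sub_dec (k : C.K) (ml : C.M × C.L) : (1 - C.dec k ml).PosSemidef := by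
  classical
  have h : 1 - C.dec k ml = ∑ x ∈ Finset.univ.erase ml, C.dec k x := by
    rw [← C.sum_dec k, ← Finset.add_sum_erase _ _ (Finset.mem_univ ml), add_sub_cancel_left]
  rw [h]
  exact posSemidef_sum _ fun x _ => C.dec_posSemidef k x

theorem errProb_eq (m : C.M) (l : C.L) (k : C.K) :
    C.errProb P m l k =
      1 - (C.dec k (m, l) * tensor fun i => P.bob (C.enc m l k i)).trace.re := by
  rw [errProb, outState, P.trRight_outSeq]

theorem trace_one_sub_dec_mul {ρ : Matrix (Fin n → b) (Fin n → b) ℂ} (hρ : IsDensity ρ) (k : C.K)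
    (ml : C.M × C.L) :
    ((1 - C.dec k ml) * ρ).trace.re = 1 - (C.dec k ml * ρ).trace.re := by
  rw [Matrix.sub_mul, Matrix.one_mul, trace_sub, hρ.2, Complex.sub_re, Complex.one_re]

theorem trace_dec_mul_mem_Icc {ρ : Matrix (Fin n → b) (Fin n → b) ℂ} (hρ : IsDensity ρ) (k : C.K)
    (ml : C.M × C.L) : (C.dec k ml * ρ).trace.re ∈ Set.Icc (0 : ℝ) 1 := by
  have h := trace_mul_re_nonneg (C.posSemidef_one_sub_dec k ml) hρ.1
  rw [C.trace_one_sub_dec_mul hρ] at h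
  exact ⟨trace_mul_re_nonneg (C.dec_posSemidef k ml) hρ.1, by linarith⟩

theorem avgErrProb_nonneg : 0 ≤ C.avgErrProb P := by
  refine mul_nonneg (by positivity) (Finset.sum_nonneg fun m _ => Finset.sum_nonneg fun l _ =>
    Finset.sum_nonneg fun k _ => ?_)
  rw [errProb_eq, sub_nonneg]
  exact (C.trace_dec_mul_mem_Icc (isDensity_tensor fun i => P.isDensity_bob _) k (m, l)).2

/-- Reliable codes need codewords of a weight of the order of the number of message bits. -/
theorem log_card_le_avgWeight_mul (hσ : supp (P.bob 1) ≤ supp (P.bob 0)) :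
    (1 - C.avgErrProb P) * Real.log ((Fintype.card C.M : ℝ) * Fintype.card C.L) -
        Real.binEntropy (1 - C.avgErrProb P) ≤
      C.avgWeight * relEntropyReal (P.bob 1) (P.bob 0) := by
  set σ₀ : Matrix (Fin n → b) (Fin n → b) ℂ := tensor fun _ => P.bob 0
  have hσ₀ : IsDensity σ₀ := isDensity_tensor fun _ => P.isDensity_bob 0
  set ρ : (C.M × C.L) × C.K → Matrix (Fin n → b) (Fin n → b) ℂ := fun j =>
    tensor fun i => P.bob (C.enc j.1.1 j.1.2 j.2 i)
  have hρ : ∀ j, IsDensity (ρ j) := fun j => isDensity_tensor fun _ => P.isDensity_bob _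
  have hsupp : ∀ x, supp (P.bob x) ≤ supp (P.bob 0) := by
    intro x
    fin_cases x
    · exact le_rfl
    · exact hσ
  have htest := fun j : (C.M × C.L) × C.K =>
    measured_relEntropy_tensor_le (fun i => P.isDensity_bob (C.enc j.1.1 j.1.2 j.2 i))
      (fun _ => P.isDensity_bob 0) (fun i => hsupp _) (κ := Fin 2)
      (Λ := ![C.dec j.2 j.1, 1 - C.dec j.2 j.1])
      (by
        intro k
        fin_cases k
        · exact C.dec_posSemidef _ _
        · exact C.posSemidef_one_sub_dec _ _)
      (by simp [Fin.sum_univ_two])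
  have h1 := fano (J := (C.M × C.L) × C.K) (m := (Fintype.card C.M : ℝ) * Fintype.card C.L)
    (p := fun j => (C.dec j.2 j.1 * ρ j).trace.re) (q := fun j => (C.dec j.2 j.1 * σ₀).trace.re)
    (D := fun j => weight (C.enc j.1.1 j.1.2 j.2) * relEntropyReal (P.bob 1) (P.bob 0))
    (a := 1 - C.avgErrProb P)
    (by exact_mod_cast Nat.mul_pos (Fintype.card_pos (α := C.M)) (Fintype.card_pos (α := C.L)))
    (fun j => (C.trace_dec_mul_mem_Icc (hρ j) _ _).1)
    (fun j => (C.trace_dec_mul_mem_Icc (hρ j) _ _).2)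
    (fun j => (C.trace_dec_mul_mem_Icc hσ₀ _ _).1)
    (fun j => (C.trace_dec_mul_mem_Icc hσ₀ _ _).2)
    (fun j => (htest j).1 0)
    (fun j h => by
      rw [← C.trace_one_sub_dec_mul (hρ j)]
      rw [← C.trace_one_sub_dec_mul hσ₀] at h
      exact (htest j).1 1 h)
    (fun j => by
      have := (htest j).2
      rw [sum_relEntropyReal_eq_weight_mul P.bob, Fin.sum_univ_two] at this
      rw [← C.trace_one_sub_dec_mul (hρ j), ← C.trace_one_sub_dec_mul hσ₀]
      exact this)
    ?_ ?_
  · refine h1.trans_eq ?_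
    rw [avgWeight, ← Finset.sum_mul, ← mul_assoc]
    simp only [Fintype.sum_prod_type, Fintype.card_prod, Nat.cast_mul]
  -- The reference state does not depend on the message, so for each key the success probabilities
  -- over all messages add up to `1`.
  · rw [Fintype.sum_prod_type_right]
    have : ∀ k, ∑ ml, (C.dec k ml * σ₀).trace.re = 1 := fun k => by
      rw [← Complex.re_sum, ← trace_sum, ← Matrix.sum_mul, C.sum_dec, Matrix.one_mul, hσ₀.2,
        Complex.one_re]
    simp only [this, Finset.sum_const, Finset.card_univ, nsmul_eq_mul, mul_one, Fintype.card_prod,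
      Nat.cast_mul]
    field_simp
  · have hpe : ∑ j : (C.M × C.L) × C.K, (C.dec j.2 j.1 * ρ j).trace.re =
        (Fintype.card C.M : ℝ) * Fintype.card C.L * Fintype.card C.K -
          ∑ m, ∑ l, ∑ k, C.errProb P m l k := by
      have : ∀ j : (C.M × C.L) × C.K, (C.dec j.2 j.1 * ρ j).trace.re =
          1 - C.errProb P j.1.1 j.1.2 j.2 := fun j => by
        rw [errProb_eq, sub_sub_cancel]
      simp_rw [this]
      rw [Finset.sum_sub_distrib]
      simp [Fintype.sum_prod_type, mul_assoc]
    rw [hpe, avgErrProb, Fintype.card_prod, Fintype.card_prod]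
    push_cast
    field_simp

variable [DecidableEq w]

/-- Covert and secret codes need public messages and keys in proportion to the weight of their
codewords. -/
theorem avgWeight_mul_le (hω : supp (P.willie 1) ≤ supp (P.willie 0)) {ε δcov δsec : ℝ}
    (h : C.IsCovertSecret P ε δcov δsec) :
    ∃ t, 0 ≤ t ∧ t ≤ δsec / 2 ∧
      C.avgWeight * relEntropyReal (P.willie 1) (P.willie 0) ≤
        Real.log ((Fintype.card C.L : ℝ) * Fintype.card C.K) +
          t * Real.log (Fintype.card C.M) + 2 * mixEntropy t + δcov := by
  obtain ⟨τ, hτ, hsec⟩ := h.secret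
  have hsupp : ∀ x, supp (P.willie x) ≤ supp (P.willie 0) := by
    intro x
    fin_cases x
    · exact le_rfl
    · exact hω
  set ω : C.M → C.L × C.K → Matrix (Fin n → w) (Fin n → w) ℂ := fun m lk =>
    tensor fun i => P.willie (C.enc m lk.1 lk.2 i)
  have hωd : ∀ m lk, IsDensity (ω m lk) := fun m lk => isDensity_tensor fun _ => P.isDensity_willie _
  have hρ : ∀ m, C.willieState P m =
      (1 / (Fintype.card (C.L × C.K) : ℂ)) • ∑ lk, ω m lk := fun m => by
    rw [willieState, Fintype.sum_prod_type, Fintype.card_prod, Nat.cast_mul]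
    simp only [outState, P.trLeft_outSeq]
    rfl
  refine ⟨1 / (Fintype.card C.M : ℝ) * (∑ m, traceNorm (C.willieState P m - τ)) / 2, ?_, ?_, ?_⟩
  · refine div_nonneg (mul_nonneg (by positivity) (Finset.sum_nonneg fun m _ => ?_)) zero_le_two
    have hm : IsDensity (C.willieState P m) := hρ m ▸ isDensity_avg (hωd m)
    obtain ⟨A, B, hA, hB, -, hAB⟩ := exists_jordan_decomposition (hm.1.isHermitian.sub hτ.1.isHermitian)
    rw [hAB]
    exact add_nonneg (Complex.le_def.1 hA.trace_nonneg).1 (Complex.le_def.1 hB.trace_nonneg).1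
  · linarith
  · have := avg_relEntropyReal_le hωd hτ hρ rfl (relEntropyReal_le_of_relEntropy_le h.covert)
    rw [Fintype.card_prod, Nat.cast_mul] at this
    refine le_trans (le_of_eq ?_) this
    have e : ∀ m lk, relEntropyReal (ω m lk) (tensor fun _ => P.willie 0) =
        weight (C.enc m lk.1 lk.2) * relEntropyReal (P.willie 1) (P.willie 0) := fun m lk => by
      rw [relEntropyReal_tensor (fun i => P.isDensity_willie _) (fun i => P.isDensity_willie _)
        fun i => hsupp _, sum_relEntropyReal_eq_weight_mul P.willie]
    simp_rw [e, ← Finset.sum_mul, ← Finset.mul_sum, ← Finset.sum_mul]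
    rw [avgWeight]
    simp only [Fintype.sum_prod_type]
    field_simp

end SecrecyCode

/-! ### Eliminating the weight and passing to the limit. -/

theorem eventually_key_rate_ge {a T N K p h t γ ϑ : ℕ → ℝ} {Db Dw s : ℝ} (hs : 0 ≤ s)
    (hp : Tendsto p atTop (𝓝 1)) (hh : Tendsto h atTop (𝓝 0)) (ht : Tendsto t atTop (𝓝 0))
    (hγ : Tendsto γ atTop (𝓝 0)) (hϑ : Tendsto ϑ atTop (𝓝 0))
    (hN : ∀ n, 0 ≤ N n) (hK : ∀ n, 0 ≤ K n / T n) (hh0 : ∀ᶠ n in atTop, 0 ≤ h n)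
    (hT : ∀ᶠ n in atTop, 0 < T n)
    (ha : ∀ᶠ n in atTop, Real.log 2 ≤ a n)
    (hB : ∀ᶠ n in atTop, p n * a n - h n ≤ N n * Db)
    (hW : ∀ᶠ n in atTop, N n * Dw ≤ K n + t n * a n + γ n)
    (hR : ∀ᶠ n in atTop, (1 - ϑ n) * (Db / s) ≤ a n / T n) {η : ℝ} (hη : 0 < η) :
    ∀ᶠ n in atTop, Dw / s - η ≤ K n / T n := by
  have hlog2 : 0 < Real.log 2 := Real.log_pos one_lt_two
  -- A nonpositive target, which includes `s = 0` by the convention for division, is met by any key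
  -- rate.
  by_cases htriv : Dw / s ≤ 0
  · exact Eventually.of_forall fun n => by linarith [hK n]
  have hs : 0 < s := hs.lt_of_ne fun h0 => htriv (by rw [← h0, div_zero])
  have hDw : 0 < Dw := by
    by_contra! hcon
    exact htriv (div_nonpos_of_nonpos_of_nonneg hcon hs.le)
  -- If `Db ≤ 0`, Bob's bound eventually contradicts `a n ≥ log 2`.
  rcases le_or_gt Db 0 with hDb | hDb
  · filter_upwards [hB, ha, hp.eventually_const_lt (by norm_num : (1 / 2 : ℝ) < 1),
      hh.eventually_lt_const (by positivity : 0 < Real.log 2 / 2)] with n h1 h2 h3 h4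
    have := mul_nonpos_of_nonneg_of_nonpos (hN n) hDb
    nlinarith
  -- As `a n ≥ log 2`, the additive errors `h` and `γ` become vanishing multiples of `a n`, so that
  -- `κ n * a n ≤ K n`.
  set κ : ℕ → ℝ := fun n =>
    (p n - h n / Real.log 2) * (Dw / Db) - t n - |γ n| / Real.log 2 with hκ
  have hκlim : Tendsto κ atTop (𝓝 (Dw / Db)) := by
    have := (((hp.sub (hh.div_const (Real.log 2))).mul_const (Dw / Db)).sub ht).sub
      (hγ.abs.div_const (Real.log 2))
    simpa using this
  have hlim : Tendsto (fun n => κ n * ((1 - ϑ n) * (Db / s))) atTop (𝓝 (Dw / s)) := by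
    have := hκlim.mul ((hϑ.const_sub 1).mul_const (Db / s))
    have e : Dw / Db * ((1 - 0) * (Db / s)) = Dw / s := by field_simp; ring
    rwa [e] at this
  filter_upwards [hT, ha, hB, hW, hR, hh0, hκlim.eventually_const_lt (div_pos hDw hDb),
    hlim.eventually_const_lt (sub_lt_self _ hη)] with n h1 h2 h3 h4 h5 h6 h7 h8
  have hκK : κ n * a n ≤ K n := by
    have g1 : h n ≤ h n / Real.log 2 * a n := by
      rw [div_mul_eq_mul_div, le_div_iff₀ hlog2]
      exact mul_le_mul_of_nonneg_left h2 h6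
    have g2 : γ n ≤ |γ n| / Real.log 2 * a n := by
      rw [div_mul_eq_mul_div, le_div_iff₀ hlog2]
      exact (mul_le_mul_of_nonneg_right (le_abs_self _) hlog2.le).trans
        (mul_le_mul_of_nonneg_left h2 (abs_nonneg _))
    have g3 : (p n - h n / Real.log 2) * a n ≤ N n * Db := by linarith
    have g4 : (p n - h n / Real.log 2) * a n * (Dw / Db) ≤ N n * Dw := by
      have := mul_le_mul_of_nonneg_right g3 (div_pos hDw hDb).le
      have e : N n * Db * (Dw / Db) = N n * Dw := by field_simp
      rwa [e] at this
    simp only [hκ]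
    linarith
  calc Dw / s - η ≤ κ n * ((1 - ϑ n) * (Db / s)) := h8.le
    _ ≤ κ n * (a n / T n) := mul_le_mul_of_nonneg_left h5 h7.le
    _ = κ n * a n / T n := by ring
    _ ≤ K n / T n := div_le_div_of_nonneg_right hκK h1.le

theorem exists_tendsto_zero_of_eventually_ge {u : ℕ → ℝ} {c : ℝ}
    (h : ∀ η > 0, ∀ᶠ n in atTop, c - η ≤ u n) :
    ∃ lam : ℕ → ℝ, Tendsto lam atTop (𝓝 0) ∧ ∀ n, c - lam n ≤ u n := by
  -- The actual deficit serves as the error, so the inequality holds for every `n`.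
  refine ⟨fun n => max (c - u n) 0, ?_, fun n => by linarith [le_max_left (c - u n) 0]⟩
  rw [Metric.tendsto_atTop']
  intro η hη
  obtain ⟨n₀, hn₀⟩ := eventually_atTop.1 (h (η / 2) (half_pos hη))
  refine ⟨n₀, fun n hn => ?_⟩
  rw [Real.dist_eq, sub_zero, abs_of_nonneg (le_max_right _ _)]
  exact max_lt (by linarith [hn₀ n hn.le]) hη

end CovertSecrecy

theorem theorem2 {b w : Type*} [Fintype b] [DecidableEq b] [Fintype w] [DecidableEq w]
    (P : CQChannel b w)
    (hσ : supp (P.bob 1) ≤ supp (P.bob 0))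
    (hω : supp (P.willie 1) ≤ supp (P.willie 0))
    (hne : P.willie 1 ≠ P.willie 0)
    (C : ∀ n : ℕ, SecrecyCode n b)
    (ε δcov δsec ϑ : ℕ → ℝ)
    (hε : Tendsto ε atTop (𝓝 0)) (hδcov : Tendsto δcov atTop (𝓝 0))
    (hδsec : Tendsto δsec atTop (𝓝 0)) (hϑ : Tendsto ϑ atTop (𝓝 0))
    (hcode : ∀ᶠ n in atTop, (C n).IsCovertSecret P (ε n) (δcov n) (δsec n))
    (hpublic : ∀ᶠ n in atTop, (C n).publicRate (δcov n) = 0)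
    (hpos : ∀ᶠ n in atTop, 0 < (C n).secretRate (δcov n))
    (hrate : ∀ᶠ n in atTop,
      (1 - ϑ n) * ((relEntropy (P.bob 1) (P.bob 0)).toReal /
        √(1 / 2 * chiSq (P.willie 1) (P.willie 0))) ≤ (C n).secretRate (δcov n)) :
    ∃ lam : ℕ → ℝ, Tendsto lam atTop (𝓝 0) ∧
      ∀ n,
        (relEntropy (P.willie 1) (P.willie 0)).toReal /
          √(1 / 2 * chiSq (P.willie 1) (P.willie 0)) - lam n ≤ (C n).keyRate (δcov n) := by
  rw [relEntropy_toReal hσ] at hrate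
  rw [relEntropy_toReal hω]
  refine exists_tendsto_zero_of_eventually_ge fun η hη => ?_
  have hsecret : ∀ n, ∃ t, (C n).IsCovertSecret P (ε n) (δcov n) (δsec n) → 0 ≤ t ∧
      t ≤ δsec n / 2 ∧ (C n).avgWeight * relEntropyReal (P.willie 1) (P.willie 0) ≤
        Real.log ((Fintype.card (C n).L : ℝ) * Fintype.card (C n).K) +
          t * Real.log (Fintype.card (C n).M) + 2 * mixEntropy t + δcov n := fun n => by
    by_cases h : (C n).IsCovertSecret P (ε n) (δcov n) (δsec n)
    · obtain ⟨t, ht⟩ := (C n).avgWeight_mul_le P hω h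
      exact ⟨t, fun _ => ht⟩
    · exact ⟨0, fun h' => absurd h' h⟩
  choose t ht using hsecret
  have htlim : Tendsto t atTop (𝓝 0) := by
    refine squeeze_zero' (g := fun n => δsec n / 2) (hcode.mono fun n hn => (ht n hn).1)
      (hcode.mono fun n hn => (ht n hn).2.1) ?_
    simpa using hδsec.div_const 2
  have herr : Tendsto (fun n => (C n).avgErrProb P) atTop (𝓝 0) :=
    squeeze_zero' (Eventually.of_forall fun n => (C n).avgErrProb_nonneg P)
      (hcode.mono fun n hn => hn.reliable) hε
  have hp : Tendsto (fun n => 1 - (C n).avgErrProb P) atTop (𝓝 1) := by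
    simpa using herr.const_sub 1
  -- A positive secret rate rules out a zero denominator, so the vanishing public rate comes from
  -- its numerator.
  have hlogL : ∀ᶠ n in atTop, Real.log (Fintype.card (C n).L) = 0 := by
    filter_upwards [hpublic, hpos] with n h1 h2
    refine (div_eq_zero_iff.1 h1).resolve_right fun h0 => h2.ne' ?_
    rw [SecrecyCode.secretRate, h0, div_zero]
  have hmulL : ∀ᶠ n in atTop, ∀ x : ℝ, 0 < x →
      Real.log (Fintype.card (C n).L * x) = Real.log x := by
    filter_upwards [hlogL] with n hn x hx
    rw [Real.log_mul (by simp) hx.ne', hn, zero_add]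
  refine eventually_key_rate_ge (a := fun n => Real.log (Fintype.card (C n).M))
    (T := fun n => √(n * δcov n)) (N := fun n => (C n).avgWeight)
    (K := fun n => Real.log (Fintype.card (C n).K)) (p := fun n => 1 - (C n).avgErrProb P)
    (h := fun n => Real.binEntropy (1 - (C n).avgErrProb P)) (t := t)
    (γ := fun n => 2 * mixEntropy (t n) + δcov n) (ϑ := ϑ)
    (Db := relEntropyReal (P.bob 1) (P.bob 0)) (Real.sqrt_nonneg _) hp ?_ htlim ?_ hϑ
    (fun n => ?_) (fun n => ?_) ?_ ?_ ?_ ?_ ?_ hrate hη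
  · have := (Real.binEntropy_continuous.tendsto 1).comp hp
    rwa [Real.binEntropy_one] at this
  · simpa using ((tendsto_mixEntropy htlim).const_mul 2).add hδcov
  · exact mul_nonneg (by positivity) (Finset.sum_nonneg fun m _ => Finset.sum_nonneg fun l _ =>
      Finset.sum_nonneg fun k _ => weight_nonneg _)
  · exact div_nonneg (Real.log_natCast_nonneg _) (Real.sqrt_nonneg _)
  · filter_upwards [herr.eventually_lt_const one_pos] with n hn
    exact Real.binEntropy_nonneg (by linarith) (by linarith [(C n).avgErrProb_nonneg P])
  · filter_upwards [hpos] with n hn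
    refine (Real.sqrt_nonneg _).lt_of_ne' fun h0 => hn.ne' ?_
    rw [SecrecyCode.secretRate, h0, div_zero]
  · filter_upwards [hpos] with n hn
    refine Real.log_le_log two_pos ?_
    have h1 : 1 < Fintype.card (C n).M := by
      refine Nat.lt_of_le_of_ne Fintype.card_pos fun h0 => hn.ne' ?_
      rw [SecrecyCode.secretRate, ← h0]
      simp
    exact_mod_cast h1
  · filter_upwards [hmulL] with n hn
    have := (C n).log_card_le_avgWeight_mul P hσ
    rwa [mul_comm (Fintype.card (C n).M : ℝ), hn _ (by positivity)] at this
  · filter_upwards [hmulL, hcode] with n hn hc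
    have := (ht n hc).2.2
    rw [hn _ (by positivity)] at this
    linarith
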